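/- For each $n$ let $x=x_n\in\mathbb R^n$ be a deterministic vector with exactly $k=k(n)$ nonzero entries, with sparsity pattern $I_{\rm true}=\{j: x_j\neq 0\}$, and let $y=Ax+d\in\mathbb R^m$, $m=m(n)\ge 1$, where $A\in\mathbb R^{m\times n}$ has i.i.d. $\mathcal N(0,1/m)$ entries and $d\in\mathbb R^m$ is independent of $A$ with i.i.d. $\mathcal N(0,1)$ entries. Put $$\mathrm{SNR}=\frac{\mathbf E\|Ax\|^2}{\mathbf E\|d\|^2},\qquad \mathrm{MAR}=\frac{\min_{j\in I_{\rm true}}|x_j|^2}{\|x\|^2/k}.$$ For $J\subseteq\{1,\dots,n\}$ let $P_J$ be the orthogonal projection onto the span of the columns $a_j$ of $A$ with $j\in J$, and let $\hat I_{\rm ML}=\arg\max_{|J|=k}\|P_Jy\|^2$; the event $\hat I_{\rm ML}=I_{\rm true}$ means that $I_{\rm true}$ is the unique maximizer. Suppose that $k(n)\to\infty$ and $n-k(n)\to\infty$ as $n\to\infty$. (1) If for some $\delta>0$ and all large $n$ $$m(n)<\frac{2-\delta}{\mathrm{MAR}\cdot\mathrm{SNR}}\,k\log(n-k)+k-1,$$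 then $\lim_{n\to\infty}\Pr(\hat I_{\rm ML}=I_{\rm true})=0$. If moreover $m(n)>k(n)$ for all large $n$, then even the probability that $I_{\rm true}$ is one of the maximizers tends to $0$ (so that ties may be broken in any way). (2) Consequently, for fixed SNR and MAR, $m=\Omega(k\log(n-k))$ measurements are necessary for any algorithm: let $s>0$ and $0<\rho\le 1$, and let $\hat I_n$ be any measurable estimators, functions of $(A,y)$, such that $\Pr(\hat I_n(A,y)=I_{\rm true})\to 1$ for every sequence of vectors $x_n$ with exactly $k(n)$ nonzero entries, $\mathrm{SNR}=s$ and $\mathrm{MAR}=\rho$ for all large $n$. Then $k\log(n-k)=O(m)$. -/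

import Mathlib

open MeasureTheory ProbabilityTheory Filter Topology Asymptotics
open scoped Matrix

noncomputable section

namespace SparseRecovery

/-- Sample space: a pair `(A, d)` of an `m × n` array of matrix entries and a noise vector. -/
abbrev Sample (m n : ℕ) : Type := (Fin m → Fin n → ℝ) × (Fin m → ℝ)

/-- The law of `(A, d)`: all entries are independent, those of `A` are `N(0, 1/m)` and those of
`d` are `N(0, 1)`. -/
def law (m n : ℕ) : Measure (Sample m n) :=
  (Measure.pi fun _ : Fin m => Measure.pi fun _ : Fin n => gaussianReal 0 (1 / m)).prod
    (Measure.pi fun _ : Fin m => gaussianReal 0 1)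

/-- The noiseless measurement `A x`. -/
def signal {m n : ℕ} (A : Fin m → Fin n → ℝ) (x : EuclideanSpace ℝ (Fin n)) :
    EuclideanSpace ℝ (Fin m) :=
  WithLp.toLp 2 (Matrix.of A *ᵥ x.ofLp)

/-- The observation `y = A x + d`. -/
def obs {m n : ℕ} (x : EuclideanSpace ℝ (Fin n)) (ω : Sample m n) : EuclideanSpace ℝ (Fin m) :=
  signal ω.1 x + WithLp.toLp 2 ω.2

/-- The set of positions of the nonzero entries of `x`. -/
def pattern {n : ℕ} (x : EuclideanSpace ℝ (Fin n)) : Finset (Fin n) :=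
  {j | x j ≠ 0}

/-- `SNR = E‖A x‖² / E‖d‖²`. -/
def SNR (m : ℕ) {n : ℕ} (x : EuclideanSpace ℝ (Fin n)) : ℝ :=
  (∫ ω, ‖signal ω.1 x‖ ^ 2 ∂law m n) /
    (∫ ω, ‖(WithLp.toLp 2 ω.2 : EuclideanSpace ℝ (Fin m))‖ ^ 2 ∂law m n)

/-- Minimum-to-average ratio: the least `|x_j|²` over the sparsity pattern, divided by the average
of `|x_j|²` over the sparsity pattern. -/
def MAR {n : ℕ} (x : EuclideanSpace ℝ (Fin n)) : ℝ :=
  (⨅ j : pattern x, |x j| ^ 2) / (‖x‖ ^ 2 / (pattern x).card)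

/-- The span of the columns `a_j`, `j ∈ J`, of `A`. -/
def colSpan {m n : ℕ} (A : Fin m → Fin n → ℝ) (J : Finset (Fin n)) :
    Submodule ℝ (EuclideanSpace ℝ (Fin m)) :=
  Submodule.span ℝ ((fun j => WithLp.toLp 2 fun i => A i j) '' (J : Set (Fin n)))

/-- `‖P_J y‖²`, where `P_J` is the orthogonal projection onto the span of the columns in `J`. -/
def energy {m n : ℕ} (A : Fin m → Fin n → ℝ) (y : EuclideanSpace ℝ (Fin m))
    (J : Finset (Fin n)) : ℝ :=
  ‖(colSpan A J).starProjection y‖ ^ 2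

/-- The maximizers of `‖P_J y‖²` over the index sets `J` with `k` elements. -/
def mlEstimates {m n : ℕ} (k : ℕ) (A : Fin m → Fin n → ℝ) (y : EuclideanSpace ℝ (Fin m)) :
    Set (Finset (Fin n)) :=
  {J | J.card = k ∧ ∀ J' : Finset (Fin n), J'.card = k → energy A y J' ≤ energy A y J}

end SparseRecovery

end

noncomputable section

namespace SparseRecovery

open scoped NNReal ENNReal

/-! Both halves reduce to identifying one column among `N = n - k + 1` Gaussian candidates. For
maximum likelihood, let `i` carry the smallest nonzero entry and let `K` be the pattern without `i`.
Success forces `insert i K` to beat every `insert j K`. Conditionally on the columns in `K`,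
projecting to the orthogonal complement of their span leaves independent Gaussian columns in
dimension `M = m - (k - 1)` and the observation `x i * g i + d`. The comparison becomes one of
single-column scores (`energy_insert`, `law_energy_insert_le`).

This test is hard by a change of measure (`measure_le_exp_mul_reference`). If the observation is
replaced by an independent Gaussian vector of the same marginal law, the columns are exchangeable
and a given one wins with probability at most `1/N`. With `u = x i ^ 2 / m`, the log-likelihood
ratio has mean at most `M * u / 2` and variance at most `M * u`. The hypothesis on `m` gives `M * u
≤ (2 - δ) * L` with `L = log (n - k)`, so by Chebyshev the ratio rarely exceeds `exp ((1 - δ / 4) *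
L)`, which is much smaller than `N`.

For an arbitrary estimator exchangeability is unavailable. However, the events of returning `insert
j K` are disjoint for distinct `j`, so some `j` has reference probability at most `1/N`; the same
change of measure yields a vector on which the estimator fails (`exists_hard_vector`). -/

/-- The centred Gaussian measure on `ℝ^M` with covariance `σ I`. -/
abbrev gauss (σ : ℝ≥0) (M : ℕ) : Measure (Fin M → ℝ) :=
  Measure.pi fun _ : Fin M => gaussianReal 0 σ

/-! ### Gaussian likelihood ratios and product densities. -/

/-- The density of `N(c, 1)` with respect to `N(0, s)`. -/
def likelihood (s : ℝ≥0) (c y : ℝ) : ℝ :=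
  √s * Real.exp (-(y - c) ^ 2 / 2 + y ^ 2 / (2 * s))

lemma measurable_likelihood (s : ℝ≥0) :
    Measurable (fun p : ℝ × ℝ => likelihood s p.1 p.2) := by
  unfold likelihood; fun_prop

lemma likelihood_pos {s : ℝ≥0} (hs : s ≠ 0) (c y : ℝ) : 0 < likelihood s c y := by
  have : (0 : ℝ) < s := by positivity
  unfold likelihood; positivity

lemma gaussianReal_eq_withDensity_likelihood {s : ℝ≥0} (hs : s ≠ 0) (c : ℝ) :
    gaussianReal c 1 =
      (gaussianReal 0 s).withDensity fun y => ENNReal.ofReal (likelihood s c y) := by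
  have hm : Measurable fun y => ENNReal.ofReal (likelihood s c y) :=
    ((measurable_likelihood s).comp (measurable_const.prodMk measurable_id)).ennreal_ofReal
  have hs' : (0 : ℝ) < s := by positivity
  rw [gaussianReal_of_var_ne_zero _ one_ne_zero, gaussianReal_of_var_ne_zero _ hs,
    ← withDensity_mul _ (measurable_gaussianPDF _ _) hm]
  congr 1
  ext y
  simp only [gaussianPDF, Pi.mul_apply]
  rw [← ENNReal.ofReal_mul (gaussianPDFReal_nonneg _ _ _)]
  congr 1
  simp only [gaussianPDFReal, likelihood, NNReal.coe_one, mul_one, sub_zero]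
  rw [Real.sqrt_mul (by positivity) (s : ℝ)]
  have h1 : √(s : ℝ) ≠ 0 := (Real.sqrt_pos.2 hs').ne'
  have h2 : √(2 * Real.pi) ≠ 0 := by positivity
  have : Real.exp (-(y - c) ^ 2 / 2) = Real.exp (-y ^ 2 / (2 * s)) *
      Real.exp (-(y - c) ^ 2 / 2 + y ^ 2 / (2 * s)) := by
    rw [← Real.exp_add]; congr 1; ring
  rw [this]
  field_simp

lemma pi_withDensity {ι : Type*} [Fintype ι] {α : ι → Type*} [∀ i, MeasurableSpace (α i)]
    (μ : ∀ i, Measure (α i)) [∀ i, IsProbabilityMeasure (μ i)] (f : ∀ i, α i → ℝ≥0∞)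
    (hf : ∀ i, Measurable (f i)) [∀ i, SigmaFinite ((μ i).withDensity (f i))] :
    Measure.pi (fun i => (μ i).withDensity (f i)) =
      (Measure.pi μ).withDensity fun x => ∏ i, f i (x i) := by
  refine Measure.pi_eq fun s hs => ?_
  rw [withDensity_apply _ (MeasurableSet.univ_pi hs),
    ← lintegral_indicator (MeasurableSet.univ_pi hs)]
  have h1 : (Set.univ.pi s).indicator (fun x => ∏ i, f i (x i)) =
      fun x => ∏ i, (s i).indicator (f i) (x i) := by
    ext x
    by_cases hx : x ∈ Set.univ.pi s
    · rw [Set.indicator_of_mem hx]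
      exact Finset.prod_congr rfl fun i _ => (Set.indicator_of_mem (hx i trivial) _).symm
    · rw [Set.indicator_of_notMem hx]
      simp only [Set.mem_pi, Set.mem_univ, true_implies, not_forall] at hx
      obtain ⟨i, hi⟩ := hx
      exact (Finset.prod_eq_zero (Finset.mem_univ i) (Set.indicator_of_notMem hi _)).symm
  have hm : ∀ i, Measurable ((s i).indicator (f i)) := fun i => (hf i).indicator (hs i)
  rw [h1, lintegral_prod_eq_prod_lintegral_of_indepFun Finset.univ
    (fun i (x : ∀ i, α i) => (s i).indicator (f i) (x i))
    (iIndepFun_pi fun i => (hm i).aemeasurable)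
    (fun i => (hm i).comp (measurable_pi_apply i))]
  refine Finset.prod_congr rfl fun i _ => ?_
  rw [← (measurePreserving_eval μ i).lintegral_comp (hm i) |>.symm,
    lintegral_indicator (hs i), withDensity_apply _ (hs i)]

lemma lintegral_gauss_shift {s : ℝ≥0} (hs : s ≠ 0) {M : ℕ} (c : Fin M → ℝ)
    {f : (Fin M → ℝ) → ℝ≥0∞} (hf : Measurable f) :
    ∫⁻ d, f (fun i => c i + d i) ∂gauss 1 M =
      ∫⁻ y, (∏ i, ENNReal.ofReal (likelihood s (c i) (y i))) * f y ∂gauss s M := by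
  have hm : ∀ i, Measurable fun y => ENNReal.ofReal (likelihood s (c i) y) := fun i =>
    ((measurable_likelihood s).comp (measurable_const.prodMk measurable_id)).ennreal_ofReal
  have h1 : MeasurePreserving (fun (d : Fin M → ℝ) i => c i + d i) (gauss 1 M)
      (Measure.pi fun i => gaussianReal (c i) 1) := by
    refine measurePreserving_pi _ _ fun i => ⟨by fun_prop, ?_⟩
    simpa using gaussianReal_map_const_add (μ := 0) (v := 1) (c i)
  have h2 : (Measure.pi fun i => gaussianReal (c i) 1) =
      (gauss s M).withDensity fun y => ∏ i, ENNReal.ofReal (likelihood s (c i) (y i)) := by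
    have : ∀ i, IsProbabilityMeasure
        ((gaussianReal 0 s).withDensity fun y => ENNReal.ofReal (likelihood s (c i) y)) := by
      intro i
      rw [← gaussianReal_eq_withDensity_likelihood hs]; infer_instance
    rw [← pi_withDensity _ _ hm]
    simp_rw [← gaussianReal_eq_withDensity_likelihood hs]
  rw [h1.lintegral_comp hf, h2, lintegral_withDensity_eq_lintegral_mul _ _ hf]
  · rfl
  · exact Finset.measurable_fun_prod _ fun i _ => (hm i).comp (measurable_pi_apply i)

/-! ### Moments and concentration of the log-likelihood ratio. -/

lemma integral_pow_four_gaussianReal (σ : ℝ≥0) : ∫ x, x ^ 4 ∂gaussianReal 0 σ = 3 * σ ^ 2 := by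
  have h := iteratedDeriv_mgf_zero (X := id) (μ := gaussianReal 0 σ) (by
    simp [integrableExpSet_id_gaussianReal]) 4
  simp only [mgf_id_gaussianReal, zero_mul, zero_add, Pi.pow_apply, id] at h
  rw [← h]
  -- Differentiating `p * exp (σ t² / 2)` replaces `p` by `p' + σ t p`, so the four derivatives of
  -- the moment generating function reduce to polynomial bookkeeping.
  have d1 : ∀ p q : ℝ → ℝ, (∀ t, HasDerivAt p (q t) t) →
      deriv (fun t => p t * Real.exp (σ * t ^ 2 / 2)) =
        fun t => (q t + σ * t * p t) * Real.exp (σ * t ^ 2 / 2) := by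
    intro p q hp
    ext t
    have he : HasDerivAt (fun t : ℝ => Real.exp (σ * t ^ 2 / 2))
        (Real.exp (σ * t ^ 2 / 2) * (σ * t)) t := by
      refine HasDerivAt.exp ?_
      have := (((hasDerivAt_id t).pow 2).const_mul (σ : ℝ)).div_const 2
      refine this.congr_deriv ?_
      simp; ring
    refine (((hp t).mul he).congr_deriv ?_).deriv
    ring
  simp only [iteratedDeriv_succ, iteratedDeriv_zero]
  have e1 := d1 (fun _ => 1) (fun _ => 0) (fun t => hasDerivAt_const t 1)
  have e2 := d1 (fun t => σ * t) (fun _ => σ) (fun t => by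
    simpa using (hasDerivAt_id t).const_mul (σ : ℝ))
  have e3 := d1 (fun t => σ + σ ^ 2 * t ^ 2) (fun t => σ ^ 2 * (2 * t)) (fun t => by
    simpa using (((hasDerivAt_id t).pow 2).const_mul ((σ : ℝ) ^ 2)).const_add (σ : ℝ))
  have e4 := d1 (fun t => 3 * σ ^ 2 * t + σ ^ 3 * t ^ 3)
    (fun t => 3 * σ ^ 2 + σ ^ 3 * (3 * t ^ 2)) (fun t => by
    have h1 := (hasDerivAt_id t).const_mul (3 * (σ : ℝ) ^ 2)
    have h2 := ((hasDerivAt_id t).pow 3).const_mul ((σ : ℝ) ^ 3)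
    simp only [id, Pi.pow_apply] at h1 h2
    exact (h1.add h2).congr_deriv (by simp))
  simp only [one_mul, zero_add, mul_one] at e1
  rw [e1, e2]
  rw [show (fun t : ℝ => ((σ : ℝ) + σ * t * (σ * t)) * Real.exp (σ * t ^ 2 / 2)) =
    fun t => (σ + σ ^ 2 * t ^ 2) * Real.exp (σ * t ^ 2 / 2) by ext t; ring, e3]
  rw [show (fun t : ℝ => ((σ : ℝ) ^ 2 * (2 * t) + σ * t * (σ + σ ^ 2 * t ^ 2)) *
    Real.exp (σ * t ^ 2 / 2)) =
    fun t => (3 * σ ^ 2 * t + σ ^ 3 * t ^ 3) * Real.exp (σ * t ^ 2 / 2) by ext t; ring, e4]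
  simp

lemma integrable_pow_gaussianReal (σ : ℝ≥0) (p : ℕ) :
    Integrable (fun x : ℝ => x ^ p) (gaussianReal 0 σ) := by
  have := (memLp_id_gaussianReal (μ := 0) (v := σ) p).integrable_norm_pow'
  refine (integrable_norm_iff (by fun_prop)).1 ?_
  simpa using this

lemma integral_sq_gaussianReal (σ : ℝ≥0) : ∫ x, x ^ 2 ∂gaussianReal 0 σ = σ := by
  have := variance_fun_id_gaussianReal (μ := 0) (v := σ)
  rwa [variance_of_integral_eq_zero (by fun_prop) (by simp)] at this

/-- The log-likelihood ratio of one coordinate, as a function of column entry and noise. -/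
def logRatio (σ : ℝ≥0) (v : ℝ) (p : ℝ × ℝ) : ℝ :=
  Real.log (1 + v ^ 2 * σ) / 2 +
    (v ^ 2 * p.1 ^ 2 - v ^ 2 * σ * p.2 ^ 2 + 2 * v * (p.1 * p.2)) / (2 * (1 + v ^ 2 * σ))

@[fun_prop]
lemma measurable_logRatio (σ : ℝ≥0) (v : ℝ) : Measurable (logRatio σ v) := by
  unfold logRatio; fun_prop

lemma integrable_pow_mul_pow (σ τ : ℝ≥0) (a b : ℕ) :
    Integrable (fun p : ℝ × ℝ => p.1 ^ a * p.2 ^ b)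
      ((gaussianReal 0 σ).prod (gaussianReal 0 τ)) :=
  (integrable_pow_gaussianReal σ a).mul_prod (integrable_pow_gaussianReal τ b)

lemma integral_pow_mul_pow (σ τ : ℝ≥0) (a b : ℕ) :
    ∫ p : ℝ × ℝ, p.1 ^ a * p.2 ^ b ∂((gaussianReal 0 σ).prod (gaussianReal 0 τ)) =
      (∫ x, x ^ a ∂gaussianReal 0 σ) * ∫ x, x ^ b ∂gaussianReal 0 τ :=
  integral_prod_mul (fun x : ℝ => x ^ a) (fun x : ℝ => x ^ b)

/-- The two squares have the same mean `v² σ` and cancel, and the cross term is centred. What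
remains is the mutual information of one coordinate. -/
lemma integral_logRatio (σ : ℝ≥0) (v : ℝ) :
    ∫ p, logRatio σ v p ∂((gaussianReal 0 σ).prod (gaussianReal 0 1)) =
      Real.log (1 + v ^ 2 * σ) / 2 := by
  have i1 := integrable_pow_mul_pow σ 1 2 0
  have i2 := integrable_pow_mul_pow σ 1 0 2
  have i3 := integrable_pow_mul_pow σ 1 1 1
  have e1 := integral_pow_mul_pow σ 1 2 0
  have e2 := integral_pow_mul_pow σ 1 0 2
  have e3 := integral_pow_mul_pow σ 1 1 1
  simp only [pow_zero, mul_one, one_mul, pow_one, integral_sq_gaussianReal, integral_const,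
    probReal_univ, smul_eq_mul, integral_id_gaussianReal, NNReal.coe_one] at i1 i2 i3 e1 e2 e3
  unfold logRatio
  have i4 : Integrable (fun p : ℝ × ℝ => v ^ 2 * p.1 ^ 2 - v ^ 2 * σ * p.2 ^ 2)
      ((gaussianReal 0 σ).prod (gaussianReal 0 1)) := (i1.const_mul _).sub (i2.const_mul _)
  have i5 : Integrable (fun p : ℝ × ℝ => v ^ 2 * p.1 ^ 2 - v ^ 2 * σ * p.2 ^ 2 +
      2 * v * (p.1 * p.2)) ((gaussianReal 0 σ).prod (gaussianReal 0 1)) :=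
    i4.add (i3.const_mul _)
  rw [integral_add (integrable_const _) (i5.div_const _),
    integral_const, integral_div, integral_add i4 (i3.const_mul _),
    integral_sub (i1.const_mul _) (i2.const_mul _), integral_const_mul, integral_const_mul,
    integral_const_mul, e1, e2, e3]
  simp

lemma memLp_logRatio (σ : ℝ≥0) (v : ℝ) :
    MemLp (logRatio σ v) 2 ((gaussianReal 0 σ).prod (gaussianReal 0 1)) := by
  have hg : ∀ a b : ℕ, MemLp (fun p : ℝ × ℝ => p.1 ^ a * p.2 ^ b) 2
      ((gaussianReal 0 σ).prod (gaussianReal 0 1)) := by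
    intro a b
    refine (memLp_two_iff_integrable_sq (by fun_prop)).2 ?_
    refine (integrable_pow_mul_pow σ 1 (a * 2) (b * 2)).congr (ae_of_all _ fun p => ?_)
    simp only [mul_pow, pow_mul]
  have i1 := hg 2 0
  have i2 := hg 0 2
  have i3 := hg 1 1
  simp only [pow_zero, mul_one, one_mul, pow_one] at i1 i2 i3
  have := (memLp_const (Real.log (1 + v ^ 2 * σ) / 2)).add
    ((((i1.const_mul (v ^ 2)).sub (i2.const_mul (v ^ 2 * σ))).add
      (i3.const_mul (2 * v))).mul_const (2 * (1 + v ^ 2 * (σ : ℝ)))⁻¹)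
  refine this.ae_eq (ae_of_all _ fun p => ?_)
  simp [logRatio, div_eq_mul_inv]

/-- With `u = v² σ` the moments give exactly `u / (1 + u)`; the bound `u` is enough. -/
lemma variance_logRatio_le (σ : ℝ≥0) (v : ℝ) :
    Var[logRatio σ v; (gaussianReal 0 σ).prod (gaussianReal 0 1)] ≤ v ^ 2 * σ := by
  rw [variance_eq_integral (by fun_prop), integral_logRatio]
  have key : ∀ p : ℝ × ℝ, (logRatio σ v p - Real.log (1 + v ^ 2 * σ) / 2) ^ 2 =
      (v ^ 4 * (p.1 ^ 4 * p.2 ^ 0) + v ^ 4 * σ ^ 2 * (p.1 ^ 0 * p.2 ^ 4)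
        + (4 * v ^ 2 - 2 * v ^ 4 * σ) * (p.1 ^ 2 * p.2 ^ 2)
        + 4 * v ^ 3 * (p.1 ^ 3 * p.2 ^ 1) - 4 * v ^ 3 * σ * (p.1 ^ 1 * p.2 ^ 3)) *
        ((2 * (1 + v ^ 2 * σ)) ^ 2)⁻¹ := by
    intro p
    simp only [logRatio, add_sub_cancel_left, div_pow]
    rw [div_eq_mul_inv]
    ring
  simp_rw [key]
  have i := integrable_pow_mul_pow σ 1
  have j1 : Integrable (fun p : ℝ × ℝ => v ^ 4 * (p.1 ^ 4 * p.2 ^ 0) +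
      v ^ 4 * σ ^ 2 * (p.1 ^ 0 * p.2 ^ 4)) ((gaussianReal 0 σ).prod (gaussianReal 0 1)) :=
    ((i 4 0).const_mul _).add ((i 0 4).const_mul _)
  have j2 : Integrable (fun p : ℝ × ℝ => v ^ 4 * (p.1 ^ 4 * p.2 ^ 0) +
      v ^ 4 * σ ^ 2 * (p.1 ^ 0 * p.2 ^ 4) + (4 * v ^ 2 - 2 * v ^ 4 * σ) * (p.1 ^ 2 * p.2 ^ 2))
      ((gaussianReal 0 σ).prod (gaussianReal 0 1)) := j1.add ((i 2 2).const_mul _)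
  have j3 : Integrable (fun p : ℝ × ℝ => v ^ 4 * (p.1 ^ 4 * p.2 ^ 0) +
      v ^ 4 * σ ^ 2 * (p.1 ^ 0 * p.2 ^ 4) + (4 * v ^ 2 - 2 * v ^ 4 * σ) * (p.1 ^ 2 * p.2 ^ 2) +
      4 * v ^ 3 * (p.1 ^ 3 * p.2 ^ 1)) ((gaussianReal 0 σ).prod (gaussianReal 0 1)) :=
    j2.add ((i 3 1).const_mul _)
  rw [integral_mul_const, integral_sub j3 ((i 1 3).const_mul _),
    integral_add j2 ((i 3 1).const_mul _), integral_add j1 ((i 2 2).const_mul _),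
    integral_add ((i 4 0).const_mul _) ((i 0 4).const_mul _)]
  simp_rw [integral_const_mul, integral_pow_mul_pow, integral_pow_four_gaussianReal,
    integral_sq_gaussianReal]
  simp only [pow_one, integral_id_gaussianReal, pow_zero, integral_const,
    probReal_univ, smul_eq_mul, NNReal.coe_one, mul_zero, zero_mul, add_zero, sub_zero]
  have hp : 0 < 1 + v ^ 2 * (σ : ℝ) := by positivity
  have hμ : 0 ≤ v ^ 2 * (σ : ℝ) := by positivity
  rw [← div_eq_mul_inv, div_le_iff₀ (by positivity)]
  nlinarith [pow_nonneg hμ 3, pow_nonneg hμ 2]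

/-- Chebyshev's inequality for the log-likelihood ratio in dimension `M`. -/
lemma measure_lt_sum_logRatio_le (σ : ℝ≥0) (v : ℝ) (M : ℕ) (τ : ℝ)
    (hτ : M * (v ^ 2 * σ) / 2 < τ) :
    ((gauss σ M).prod (gauss 1 M)) {p | τ < ∑ i, logRatio σ v (p.1 i, p.2 i)} ≤
      ENNReal.ofReal (M * (v ^ 2 * σ) / (τ - M * (v ^ 2 * σ) / 2) ^ 2) := by
  have hmp := measurePreserving_arrowProdEquivProdArrow ℝ ℝ (Fin M)
    (fun _ => gaussianReal 0 σ) (fun _ => gaussianReal 0 1)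
  -- Pairing column entries with noise entries coordinatewise turns the sum into one of independent
  -- identically distributed terms.
  rw [← hmp.measure_preimage_equiv]
  set P := Measure.pi fun _ : Fin M => (gaussianReal 0 σ).prod (gaussianReal 0 1)
  have hmem : ∀ i : Fin M, MemLp (fun q : Fin M → ℝ × ℝ => logRatio σ v (q i)) 2 P := fun i =>
    (memLp_logRatio σ v).comp_measurePreserving (measurePreserving_eval _ i)
  have hS : MemLp (∑ i, fun q : Fin M → ℝ × ℝ => logRatio σ v (q i)) 2 P :=
    memLp_finsetSum' _ fun i _ => hmem i
  have hE : P[∑ i, fun q : Fin M → ℝ × ℝ => logRatio σ v (q i)] =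
      M * (Real.log (1 + v ^ 2 * σ) / 2) := by
    simp only [Finset.sum_apply]
    rw [integral_finsetSum _ fun i _ => (hmem i).integrable one_le_two]
    rw [Finset.sum_congr rfl fun i _ =>
      (integral_comp_eval (μ := fun _ : Fin M => (gaussianReal 0 σ).prod (gaussianReal 0 1))
        (i := i) (f := logRatio σ v) (by fun_prop))]
    simp [integral_logRatio]
  have hV : Var[∑ i, fun q : Fin M → ℝ × ℝ => logRatio σ v (q i); P] ≤ M * (v ^ 2 * σ) := by
    rw [variance_sum_pi (X := fun _ => logRatio σ v) fun _ => memLp_logRatio σ v]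
    simpa using mul_le_mul_of_nonneg_left (variance_logRatio_le σ v) (Nat.cast_nonneg M)
  have hμ : 0 ≤ v ^ 2 * (σ : ℝ) := by positivity
  have hlog : Real.log (1 + v ^ 2 * σ) ≤ v ^ 2 * σ := by
    have := Real.log_le_sub_one_of_pos (show 0 < 1 + v ^ 2 * (σ : ℝ) by positivity)
    linarith
  have hmean : (M : ℝ) * (Real.log (1 + v ^ 2 * σ) / 2) ≤ M * (v ^ 2 * σ) / 2 := by
    have := mul_le_mul_of_nonneg_left hlog (Nat.cast_nonneg (α := ℝ) M)
    linarith
  refine (measure_mono ?_).trans ((meas_ge_le_variance_div_sq hS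
    (sub_pos.2 hτ)).trans (ENNReal.ofReal_le_ofReal ?_))
  · intro q hq
    have hq' : τ < ∑ i, logRatio σ v (q i) := hq
    rw [Set.mem_ofPred_eq, hE, Finset.sum_apply]
    exact le_trans (by linarith) (le_abs_self _)
  · gcongr

/-! ### Change of measure to an independent observation. -/

lemma prod_likelihood_eq_exp {σ : ℝ≥0} {v : ℝ} {s : ℝ≥0} (hs : (s : ℝ) = 1 + v ^ 2 * σ) {M : ℕ}
    (g d : Fin M → ℝ) :
    ∏ i, likelihood s (v * g i) (v * g i + d i) =
      Real.exp (∑ i, logRatio σ v (g i, d i)) := by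
  rw [Real.exp_sum]
  refine Finset.prod_congr rfl fun i _ => ?_
  have hp : 0 < 1 + v ^ 2 * (σ : ℝ) := by positivity
  simp only [likelihood, logRatio, hs]
  rw [Real.exp_add (Real.log _ / 2), Real.exp_half, Real.exp_log hp]
  congr 2
  field_simp
  ring

lemma measurable_prod_likelihood {ι : Type*} (s : ℝ≥0) (v : ℝ) {M : ℕ} (j : ι) :
    Measurable fun p : (ι → Fin M → ℝ) × (Fin M → ℝ) =>
      ∏ i, likelihood s (v * p.1 j i) (p.2 i) := by
  unfold likelihood
  fun_prop

/-- Change of measure: the probability of an event under the observation `v g_j + d` is controlled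
by its probability when the observation is an independent `N(0, 1 + v² σ)` vector. -/
theorem measure_le_exp_mul_reference {ι : Type*} [Fintype ι] (σ : ℝ≥0) (v : ℝ) {s : ℝ≥0}
    (hs : (s : ℝ) = 1 + v ^ 2 * σ) {M : ℕ} (j : ι) {τ : ℝ} (hτ : M * (v ^ 2 * σ) / 2 < τ)
    {F : Set ((ι → Fin M → ℝ) × (Fin M → ℝ))} (hF : MeasurableSet F) :
    ((Measure.pi fun _ : ι => gauss σ M).prod (gauss 1 M))
        {p | (p.1, fun i => v * p.1 j i + p.2 i) ∈ F} ≤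
      ENNReal.ofReal (Real.exp τ) * ((Measure.pi fun _ : ι => gauss σ M).prod (gauss s M)) F +
        ENNReal.ofReal (M * (v ^ 2 * σ) / (τ - M * (v ^ 2 * σ) / 2) ^ 2) := by
  have hs0 : s ≠ 0 := by
    rintro rfl
    have : 0 ≤ v ^ 2 * (σ : ℝ) := by positivity
    simp only [NNReal.coe_zero] at hs
    linarith
  let Λ : (Fin M → ℝ) → (Fin M → ℝ) → ℝ := fun g y => ∏ i, likelihood s (v * g i) (y i)
  have hΛ : Measurable fun p : (ι → Fin M → ℝ) × (Fin M → ℝ) => Λ (p.1 j) p.2 :=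
    measurable_prod_likelihood s v j
  -- `F` is truncated to where the likelihood ratio is at most `exp τ`: there the density costs a
  -- factor `exp τ`, and the discarded part is left to Chebyshev.
  let G : Set ((ι → Fin M → ℝ) × (Fin M → ℝ)) := F ∩ {p | Λ (p.1 j) p.2 ≤ Real.exp τ}
  have hG : MeasurableSet G := hF.inter (measurableSet_le hΛ measurable_const)
  have hmap : Measurable fun p : (ι → Fin M → ℝ) × (Fin M → ℝ) =>
      (p.1, fun i => v * p.1 j i + p.2 i) := by fun_prop
  have hsub : {p : (ι → Fin M → ℝ) × (Fin M → ℝ) | (p.1, fun i => v * p.1 j i + p.2 i) ∈ F} ⊆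
      {p | (p.1, fun i => v * p.1 j i + p.2 i) ∈ G} ∪
        {p | τ < ∑ i, logRatio σ v (p.1 j i, p.2 i)} := by
    intro p hp
    by_cases h : τ < ∑ i, logRatio σ v (p.1 j i, p.2 i)
    · exact Or.inr h
    · refine Or.inl ⟨hp, ?_⟩
      simp only [Set.mem_ofPred_eq, Λ]
      rw [prod_likelihood_eq_exp hs]
      exact Real.exp_le_exp.2 (not_lt.1 h)
  refine (measure_mono hsub).trans ((measure_union_le _ _).trans (add_le_add ?_ ?_))
  · have hG' : MeasurableSet {p : (ι → Fin M → ℝ) × (Fin M → ℝ) |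
        (p.1, fun i => v * p.1 j i + p.2 i) ∈ G} := hmap hG
    rw [Measure.prod_apply hG', Measure.prod_apply hF, ← lintegral_const_mul' _ _ (by simp)]
    refine lintegral_mono fun g => ?_
    have hGg : MeasurableSet (Prod.mk g ⁻¹' G) := measurable_prodMk_left hG
    calc gauss 1 M (Prod.mk g ⁻¹' {p | (p.1, fun i => v * p.1 j i + p.2 i) ∈ G})
        = ∫⁻ d, (Prod.mk g ⁻¹' G).indicator 1 (fun i => v * g j i + d i) ∂gauss 1 M := by
          rw [← lintegral_indicator_one (measurable_prodMk_left hG')]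
          rfl
      _ = ∫⁻ y, (∏ i, ENNReal.ofReal (likelihood s (v * g j i) (y i))) *
            (Prod.mk g ⁻¹' G).indicator 1 y ∂gauss s M :=
          lintegral_gauss_shift hs0 (fun i => v * g j i) (measurable_one.indicator hGg)
      _ ≤ ∫⁻ y, ENNReal.ofReal (Real.exp τ) * (Prod.mk g ⁻¹' F).indicator 1 y ∂gauss s M := by
          refine lintegral_mono fun y => ?_
          by_cases hy : (g, y) ∈ G
          · rw [Set.indicator_of_mem (show y ∈ Prod.mk g ⁻¹' G from hy),
              Set.indicator_of_mem (show y ∈ Prod.mk g ⁻¹' F from hy.1),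
              ← ENNReal.ofReal_prod_of_nonneg fun i _ => (likelihood_pos hs0 _ _).le]
            exact mul_le_mul_left (ENNReal.ofReal_le_ofReal hy.2) _
          · rw [Set.indicator_of_notMem (show y ∉ Prod.mk g ⁻¹' G from hy)]
            simp
      _ = ENNReal.ofReal (Real.exp τ) * gauss s M (Prod.mk g ⁻¹' F) := by
          rw [lintegral_const_mul' _ _ (by simp),
            lintegral_indicator_one (measurable_prodMk_left hF)]
  · have hpr : MeasurePreserving (Prod.map (Function.eval j) id)
        ((Measure.pi fun _ : ι => gauss σ M).prod (gauss 1 M)) ((gauss σ M).prod (gauss 1 M)) :=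
      (measurePreserving_eval (fun _ : ι => gauss σ M) j).prod (MeasurePreserving.id _)
    have hme : MeasurableSet {p : (Fin M → ℝ) × (Fin M → ℝ) |
        τ < ∑ i, logRatio σ v (p.1 i, p.2 i)} := by
      refine measurableSet_lt measurable_const ?_
      fun_prop
    rw [show {p : (ι → Fin M → ℝ) × (Fin M → ℝ) | τ < ∑ i, logRatio σ v (p.1 j i, p.2 i)} =
      Prod.map (Function.eval j) id ⁻¹' {p : (Fin M → ℝ) × (Fin M → ℝ) |
        τ < ∑ i, logRatio σ v (p.1 i, p.2 i)} from rfl,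
      hpr.measure_preimage hme.nullMeasurableSet]
    exact measure_lt_sum_logRatio_le σ v M τ hτ

/-! ### Absolute continuity and symmetries of product measures. -/

lemma pi_fin_absolutelyContinuous {α : Type*} [MeasurableSpace α] {μ ν : Measure α}
    [SigmaFinite μ] [SigmaFinite ν] (h : μ ≪ ν) (r : ℕ) :
    Measure.pi (fun _ : Fin r => μ) ≪ Measure.pi (fun _ : Fin r => ν) := by
  induction r with
  | zero => rw [Measure.pi_of_empty _ isEmptyElim, Measure.pi_of_empty _ isEmptyElim]
  | succ r ih =>
    let e := MeasurableEquiv.piFinSuccAbove (fun _ : Fin (r + 1) => α) 0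
    have h1 := (measurePreserving_piFinSuccAbove (fun _ : Fin (r + 1) => μ) 0).symm e
    have h2 := (measurePreserving_piFinSuccAbove (fun _ : Fin (r + 1) => ν) 0).symm e
    rw [← h1.map_eq, ← h2.map_eq]
    exact (h.prod ih).map e.symm.measurable

lemma pi_absolutelyContinuous {ι α : Type*} [Fintype ι] [MeasurableSpace α] {μ ν : Measure α}
    [SigmaFinite μ] [SigmaFinite ν] (h : μ ≪ ν) :
    Measure.pi (fun _ : ι => μ) ≪ Measure.pi (fun _ : ι => ν) := by
  let e := Fintype.equivFin ι
  have h1 := measurePreserving_arrowCongr' (fun _ => μ) (fun _ => μ) e.symm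
    (MeasurableEquiv.refl α) (fun _ => MeasurePreserving.id _)
  have h2 := measurePreserving_arrowCongr' (fun _ => ν) (fun _ => ν) e.symm
    (MeasurableEquiv.refl α) (fun _ => MeasurePreserving.id _)
  rw [← h1.map_eq, ← h2.map_eq]
  exact (pi_fin_absolutelyContinuous h _).map (MeasurableEquiv.measurable _)

lemma gauss_absolutelyContinuous {σ : ℝ≥0} (hσ : σ ≠ 0) (M : ℕ) : gauss σ M ≪ volume :=
  pi_absolutelyContinuous (gaussianReal_absolutelyContinuous 0 hσ)

/-- Exchanging rows and columns of an array with independent identically distributed entries. -/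
lemma measurePreserving_swap {ι κ : Type*} [Fintype ι] [Fintype κ] (μ : Measure ℝ)
    [IsProbabilityMeasure μ] :
    MeasurePreserving (fun (A : ι → κ → ℝ) j i => A i j)
      (Measure.pi fun _ : ι => Measure.pi fun _ : κ => μ)
      (Measure.pi fun _ : κ => Measure.pi fun _ : ι => μ) := by
  have hm : Measurable fun (A : ι → κ → ℝ) j i => A i j := by fun_prop
  -- Only boxes are tested: a product of arbitrary sets of columns need not be a product of sets of
  -- rows, whereas boxes in all the entries are exchanged.
  refine ⟨hm, (Measure.pi_eq_generateFrom (fun _ => generateFrom_pi) (fun _ => isPiSystem_pi)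
    (fun _ => Measure.FiniteSpanningSetsIn.pi fun _ => μ.toFiniteSpanningSetsIn) ?_).symm⟩
  intro s hs
  choose t ht hst using hs
  have hs' : ∀ j, MeasurableSet (s j) := fun j => by
    rw [← hst j]
    exact MeasurableSet.univ_pi fun i => ht j i trivial
  rw [Measure.map_apply hm (MeasurableSet.univ_pi hs')]
  have : (fun (A : ι → κ → ℝ) j i => A i j) ⁻¹' Set.univ.pi s =
      Set.univ.pi fun i => Set.univ.pi fun j => t j i := by
    ext A
    simp only [← hst, Set.mem_preimage, Set.mem_pi, Set.mem_univ, true_implies]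
    exact forall_comm
  rw [this]
  simp_rw [← hst, Measure.pi_pi]
  exact Finset.prod_comm

/-- Among independent identically distributed variables, a given one is the strict maximizer of
a score with probability at most the inverse of their number. -/
lemma measure_strict_argmax_le {ι α : Type*} [Fintype ι] [MeasurableSpace α]
    (μ : Measure α) [IsProbabilityMeasure μ] {s : α → ℝ} (hs : Measurable s) (i : ι) :
    Measure.pi (fun _ : ι => μ) {g | ∀ l, l ≠ i → s (g l) < s (g i)} ≤
      (Fintype.card ι : ℝ≥0∞)⁻¹ := by
  classical
  let E : ι → Set (ι → α) := fun j => {g | ∀ l, l ≠ j → s (g l) < s (g j)}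
  have hE : ∀ j, MeasurableSet (E j) := fun j => by
    simp only [E, Set.ofPred_forall]
    refine MeasurableSet.iInter fun l => MeasurableSet.iInter fun _ => ?_
    exact measurableSet_lt (hs.comp (measurable_pi_apply l)) (hs.comp (measurable_pi_apply j))
  -- Exchanging coordinates `i` and `j` preserves the product measure and carries one event to the
  -- other.
  have hsame : ∀ j, Measure.pi (fun _ : ι => μ) (E j) = Measure.pi (fun _ : ι => μ) (E i) := by
    intro j
    have h1 := measurePreserving_arrowCongr' (fun _ => μ) (fun _ => μ) (Equiv.swap i j)
      (MeasurableEquiv.refl α) (fun _ => MeasurePreserving.id _)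
    rw [← h1.measure_preimage (hE i).nullMeasurableSet]
    congr 1
    ext g
    have hg : ∀ l, MeasurableEquiv.arrowCongr' (Equiv.swap i j) (MeasurableEquiv.refl α) g l =
        g (Equiv.swap i j l) := fun l => rfl
    simp only [E, Set.mem_preimage, Set.mem_ofPred_eq, hg, Equiv.swap_apply_left]
    constructor
    · intro h l hl
      exact h _ fun h' => hl (by rw [Equiv.swap_apply_eq_iff, Equiv.swap_apply_right] at h'; exact h')
    · intro h l hl
      have := h (Equiv.swap i j l) fun h' => hl (by
        rw [Equiv.swap_apply_eq_iff, Equiv.swap_apply_left] at h'; exact h')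
      simpa using this
  have hdisj : Pairwise (Function.onFun Disjoint E) := by
    intro a b hab
    refine Set.disjoint_left.2 fun g ha hb => ?_
    exact lt_asymm (ha b hab.symm) (hb a hab)
  have hsum : (Fintype.card ι : ℝ≥0∞) * Measure.pi (fun _ : ι => μ) (E i) ≤ 1 := by
    calc (Fintype.card ι : ℝ≥0∞) * Measure.pi (fun _ : ι => μ) (E i)
        = ∑ j, Measure.pi (fun _ : ι => μ) (E j) := by simp [hsame]
      _ = Measure.pi (fun _ : ι => μ) (⋃ j, E j) := by
          rw [measure_iUnion hdisj hE, tsum_fintype]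
      _ ≤ 1 := prob_le_one
  rw [ENNReal.le_inv_iff_mul_le, mul_comm]
  exact hsum

/-! ### The single-column test and its ties. -/

/-- The squared length of the projection of `y` onto the line through `g`. -/
def score {M : ℕ} (g y : Fin M → ℝ) : ℝ := (g ⬝ᵥ y) ^ 2 / (g ⬝ᵥ g)

lemma measurable_score_apply {ι : Type*} {M : ℕ} (l : ι) :
    Measurable fun p : (ι → Fin M → ℝ) × (Fin M → ℝ) => score (p.1 l) p.2 := by
  unfold score dotProduct
  fun_prop

lemma measurable_score_left {M : ℕ} (y : Fin M → ℝ) : Measurable fun g => score g y := by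
  unfold score dotProduct
  fun_prop

/-- The form `(e ⬝ᵥ y)² - c (e ⬝ᵥ e)` cannot vanish identically, since a nonzero rank-one form is
not a multiple of the identity in dimension at least two. The witness is `y` itself, or a nonzero
vector orthogonal to `y` when `c = y ⬝ᵥ y`. -/
lemma exists_quadratic_ne {M : ℕ} (hM : 2 ≤ M) {y : Fin M → ℝ} (hy : y ≠ 0) (c : ℝ) :
    ∃ e : Fin M → ℝ, (e ⬝ᵥ y) ^ 2 - c * (e ⬝ᵥ e) ≠ 0 := by
  have hyy : y ⬝ᵥ y ≠ 0 := fun h => hy (dotProduct_self_eq_zero.1 h)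
  by_cases hc : c = y ⬝ᵥ y
  · obtain ⟨a, ha⟩ : ∃ a, y a ≠ 0 := Function.ne_iff.1 hy
    have : Nontrivial (Fin M) := Fin.nontrivial_iff_two_le.2 hM
    obtain ⟨b, hb⟩ := exists_ne a
    let e : Fin M → ℝ := y b • Pi.single a 1 - y a • Pi.single b 1
    have h1 : e ⬝ᵥ y = 0 := by
      simp only [e, sub_dotProduct, smul_dotProduct, single_dotProduct, smul_eq_mul]
      ring
    have h2 : e ≠ 0 := fun h => ha (by simpa [e, hb.symm, hb] using congrFun h b)
    refine ⟨e, ?_⟩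
    rw [h1, hc]
    have := mul_ne_zero hyy (fun h => h2 (dotProduct_self_eq_zero.1 h))
    simpa using this
  · refine ⟨y, ?_⟩
    have : (y ⬝ᵥ y) ^ 2 - c * (y ⬝ᵥ y) = (y ⬝ᵥ y - c) * (y ⬝ᵥ y) := by ring
    rw [this]
    exact mul_ne_zero (sub_ne_zero.2 (Ne.symm hc)) hyy

/-- A quadratic polynomial with nonzero leading coefficient vanishes on a null set. -/
lemma ae_quadratic_ne_zero {a b c : ℝ} (ha : a ≠ 0) :
    ∀ᵐ t : ℝ, a * t ^ 2 + b * t + c ≠ 0 := by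
  open Polynomial in
  have hp : (C a * X ^ 2 + C b * X + C c : ℝ[X]) ≠ 0 := by
    intro h
    have := congrArg (fun p : ℝ[X] => p.coeff 2) h
    simp at this
    exact ha this
  have hfin := Polynomial.finite_setOfPred_isRoot hp
  rw [ae_iff]
  refine measure_mono_null ?_ (hfin.measure_zero volume)
  intro t ht
  simpa [Polynomial.IsRoot] using ht

/-- Every line in a direction where the quadratic form is nonzero meets the cone in at most two
points, so the cone is Lebesgue null. This is what excludes ties between scores. -/
lemma gauss_cone_null {σ : ℝ≥0} (hσ : σ ≠ 0) {M : ℕ} (hM : 2 ≤ M) {y : Fin M → ℝ} (hy : y ≠ 0)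
    (c : ℝ) : ∀ᵐ g ∂gauss σ M, (g ⬝ᵥ y) ^ 2 ≠ c * (g ⬝ᵥ g) := by
  refine (gauss_absolutelyContinuous hσ M).ae_le ?_
  obtain ⟨e, he⟩ := exists_quadratic_ne hM hy c
  refine ae_mem_of_ae_add_linearMap_mem (𝕜 := ℝ) (LinearMap.toSpanSingleton ℝ (Fin M → ℝ) e)
    (volume : Measure ℝ) (volume : Measure (Fin M → ℝ))
    (s := {g | (g ⬝ᵥ y) ^ 2 ≠ c * (g ⬝ᵥ g)}) ?_ ?_
  · refine (measurableSet_eq_fun ?_ ?_).compl <;> (unfold dotProduct; fun_prop)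
  · intro g
    filter_upwards [ae_quadratic_ne_zero (b := 2 * ((g ⬝ᵥ y) * (e ⬝ᵥ y) - c * (g ⬝ᵥ e)))
      (c := (g ⬝ᵥ y) ^ 2 - c * (g ⬝ᵥ g)) he] with t ht
    simp only [LinearMap.toSpanSingleton_apply, add_dotProduct, dotProduct_add,
      smul_dotProduct, dotProduct_smul, smul_eq_mul, dotProduct_comm e g]
    intro h
    apply ht
    linear_combination h

lemma ae_score_ne {σ : ℝ≥0} (hσ : σ ≠ 0) {M : ℕ} (hM : 2 ≤ M) {y : Fin M → ℝ} (hy : y ≠ 0)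
    (c : ℝ) : ∀ᵐ g ∂gauss σ M, score g y ≠ c := by
  have h0 : ∀ᵐ g ∂gauss σ M, g ≠ 0 := by
    filter_upwards [gauss_cone_null hσ hM hy 0] with g hg h
    simp [h] at hg
  filter_upwards [gauss_cone_null hσ hM hy c, h0] with g hg hg0 h
  refine hg ?_
  have : g ⬝ᵥ g ≠ 0 := fun h => hg0 (dotProduct_self_eq_zero.1 h)
  rw [← h, score, div_mul_cancel₀ _ this]

/-- Lower bound on the error of the single-column maximum likelihood test, strict version. -/
theorem measure_score_lt_le {ι : Type*} [Fintype ι] (σ : ℝ≥0) (v : ℝ) {M : ℕ} (i : ι) {τ : ℝ}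
    (hτ : M * (v ^ 2 * σ) / 2 < τ) :
    ((Measure.pi fun _ : ι => gauss σ M).prod (gauss 1 M))
        {p | ∀ l, l ≠ i → score (p.1 l) (fun a => v * p.1 i a + p.2 a) <
          score (p.1 i) (fun a => v * p.1 i a + p.2 a)} ≤
      ENNReal.ofReal (Real.exp τ) * (Fintype.card ι : ℝ≥0∞)⁻¹ +
        ENNReal.ofReal (M * (v ^ 2 * σ) / (τ - M * (v ^ 2 * σ) / 2) ^ 2) := by
  let s : ℝ≥0 := 1 + (v ^ 2).toNNReal * σ
  have hs : (s : ℝ) = 1 + v ^ 2 * σ := by simp [s, sq_nonneg]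
  let F : Set ((ι → Fin M → ℝ) × (Fin M → ℝ)) :=
    {p | ∀ l, l ≠ i → score (p.1 l) p.2 < score (p.1 i) p.2}
  have hsm : ∀ l, Measurable fun p : (ι → Fin M → ℝ) × (Fin M → ℝ) => score (p.1 l) p.2 :=
    measurable_score_apply
  have hF : MeasurableSet F := by
    simp only [F, Set.ofPred_forall]
    refine MeasurableSet.iInter fun l => MeasurableSet.iInter fun _ => ?_
    exact measurableSet_lt (hsm l) (hsm i)
  refine (measure_le_exp_mul_reference σ v hs i hτ hF).trans ?_
  gcongr
  -- Under the reference law the observation is independent of the columns, so it can be frozen and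
  -- exchangeability applied to the columns alone.
  rw [Measure.prod_apply_symm hF]
  refine (lintegral_mono fun y => measure_strict_argmax_le (gauss σ M)
    (measurable_score_left y) i).trans ?_
  simp

/-- Lower bound on the error of the single-column maximum likelihood test, allowing ties. -/
theorem measure_score_le_le {ι : Type*} [Fintype ι] {σ : ℝ≥0} (hσ : σ ≠ 0) (v : ℝ) {M : ℕ}
    (hM : 2 ≤ M) (i : ι) {τ : ℝ} (hτ : M * (v ^ 2 * σ) / 2 < τ) :
    ((Measure.pi fun _ : ι => gauss σ M).prod (gauss 1 M))
        {p | ∀ l, l ≠ i → score (p.1 l) (fun a => v * p.1 i a + p.2 a) ≤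
          score (p.1 i) (fun a => v * p.1 i a + p.2 a)} ≤
      ENNReal.ofReal (Real.exp τ) * (Fintype.card ι : ℝ≥0∞)⁻¹ +
        ENNReal.ofReal (M * (v ^ 2 * σ) / (τ - M * (v ^ 2 * σ) / 2) ^ 2) := by
  classical
  let s : ℝ≥0 := 1 + (v ^ 2).toNNReal * σ
  have hs : (s : ℝ) = 1 + v ^ 2 * σ := by simp [s, sq_nonneg]
  have hs0 : s ≠ 0 := by positivity
  let F : Set ((ι → Fin M → ℝ) × (Fin M → ℝ)) :=
    {p | ∀ l, l ≠ i → score (p.1 l) p.2 ≤ score (p.1 i) p.2}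
  have hsm : ∀ l, Measurable fun p : (ι → Fin M → ℝ) × (Fin M → ℝ) => score (p.1 l) p.2 :=
    measurable_score_apply
  have hF : MeasurableSet F := by
    simp only [F, Set.ofPred_forall]
    refine MeasurableSet.iInter fun l => MeasurableSet.iInter fun _ => ?_
    exact measurableSet_le (hsm l) (hsm i)
  refine (measure_le_exp_mul_reference σ v hs i hτ hF).trans ?_
  gcongr
  rw [Measure.prod_apply_symm hF]
  have hy : ∀ᵐ y ∂gauss s M, y ≠ 0 := by
    have h1 : (Pi.single ⟨0, by omega⟩ 1 : Fin M → ℝ) ≠ 0 := by simp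
    filter_upwards [gauss_cone_null hs0 hM h1 0] with g hg h
    simp [h] at hg
  have hb : ∀ᵐ y ∂gauss s M, Measure.pi (fun _ : ι => gauss σ M) ((fun g => (g, y)) ⁻¹' F) ≤
      (Fintype.card ι : ℝ≥0∞)⁻¹ := by
    filter_upwards [hy] with y hy
    have hsy := measurable_score_left y
    refine le_trans (measure_mono_ae ?_) (measure_strict_argmax_le (gauss σ M) hsy i)
    -- For fixed `y ≠ 0` two independent columns almost surely have different scores, so the weak
    -- maximizer is strict.
    have hne : ∀ l, l ≠ i → ∀ᵐ g ∂Measure.pi (fun _ : ι => gauss σ M),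
        score (g l) y ≠ score (g i) y := by
      intro l hl
      have hind : IndepFun (fun g : ι → Fin M → ℝ => g l) (fun g => g i)
          (Measure.pi fun _ : ι => gauss σ M) :=
        (iIndepFun_pi (X := fun _ => id) (fun _ => aemeasurable_id)).indepFun hl
      have hmap := (indepFun_iff_map_prod_eq_prod_map_map (measurable_pi_apply l).aemeasurable
        (measurable_pi_apply i).aemeasurable).1 hind
      have e1 := (measurePreserving_eval (fun _ : ι => gauss σ M) l).map_eq
      have e2 := (measurePreserving_eval (fun _ : ι => gauss σ M) i).map_eq
      change Measure.map (fun g : ι → Fin M → ℝ => g l) _ = _ at e1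
      change Measure.map (fun g : ι → Fin M → ℝ => g i) _ = _ at e2
      rw [e1, e2] at hmap
      have hset : MeasurableSet {q : (Fin M → ℝ) × (Fin M → ℝ) | score q.1 y ≠ score q.2 y} :=
        (measurableSet_eq_fun (hsy.comp measurable_fst) (hsy.comp measurable_snd)).compl
      have hae : ∀ᵐ q ∂(gauss σ M).prod (gauss σ M), score q.1 y ≠ score q.2 y := by
        rw [← Measure.prod_swap, ae_map_iff measurable_swap.aemeasurable hset]
        refine (Measure.ae_prod_iff_ae_ae (measurable_swap hset)).2 (ae_of_all _ fun g => ?_)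
        filter_upwards [ae_score_ne hσ hM hy (score g y)] with g' hg' using hg'
      rw [← hmap] at hae
      exact ae_of_ae_map (f := fun g : ι → Fin M → ℝ => (g l, g i)) (by fun_prop) hae
    have hall : ∀ᵐ g ∂Measure.pi (fun _ : ι => gauss σ M),
        ∀ l, l ≠ i → score (g l) y ≠ score (g i) y := by
      refine ae_all_iff.2 fun l => ?_
      by_cases h : l = i
      · simp [h]
      · filter_upwards [hne l h] with g hg _ using hg
    filter_upwards [hall] with g hg hgF l hl
    exact lt_of_le_of_ne (hgF l hl) (hg l hl)
  refine (lintegral_mono_ae hb).trans ?_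
  simp

/-! ### Generic position and orthonormal coordinates of Gaussian vectors. -/

/-- At most `m` of a family of independent Gaussian vectors in `ℝ^m` are almost surely linearly
independent. -/
lemma ae_linearIndependent {ι κ : Type*} [Fintype ι] [Fintype κ] {σ : ℝ≥0} (hσ : σ ≠ 0) {m : ℕ}
    (h : κ ↪ ι) (hκ : Fintype.card κ ≤ m) :
    ∀ᵐ g ∂Measure.pi (fun _ : ι => gauss σ m), LinearIndependent ℝ (g ∘ h) := by
  classical
  refine (pi_absolutelyContinuous (gauss_absolutelyContinuous hσ m)).ae_le ?_
  obtain ⟨f⟩ : Nonempty (κ ↪ Fin m) := Function.Embedding.nonempty_of_card_le (by simpa using hκ)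
  -- Moving along `E` adds `t` times the identity to a square submatrix `B`. Its determinant is then
  -- the characteristic polynomial of `-B` at `t`, which has finitely many zeros.
  let E : ι → Fin m → ℝ := Function.extend h (fun j => Pi.single (f j) 1) 0
  have hE : ∀ j, E (h j) = Pi.single (f j) 1 := fun j => h.injective.extend_apply _ _ j
  have hcont : Continuous fun g : ι → Fin m → ℝ => g ∘ h :=
    continuous_pi fun j => continuous_apply (h j)
  refine ae_mem_of_ae_add_linearMap_mem (𝕜 := ℝ) (LinearMap.toSpanSingleton ℝ _ E)
    (volume : Measure ℝ) (volume : Measure (ι → Fin m → ℝ))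
    (s := {g | LinearIndependent ℝ (g ∘ h)})
    (isOpen_setOfPred_linearIndependent.preimage hcont).measurableSet ?_
  intro g
  let B : Matrix κ κ ℝ := Matrix.of fun j j' => g (h j) (f j')
  have hfin := Polynomial.finite_setOfPred_isRoot (Matrix.charpoly_monic (-B)).ne_zero
  have : ∀ᵐ t : ℝ, ¬ (-B).charpoly.IsRoot t := by
    rw [ae_iff]
    simpa using hfin.measure_zero volume
  filter_upwards [this] with t ht
  rw [Polynomial.IsRoot, Matrix.eval_charpoly] at ht
  have hrow := Matrix.linearIndependent_rows_of_det_ne_zero ht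
  refine LinearIndependent.of_comp (LinearMap.funLeft ℝ ℝ f) ?_
  have hcomp : (LinearMap.funLeft ℝ ℝ f) ∘ ((g + LinearMap.toSpanSingleton ℝ _ E t) ∘ h) =
      fun i => (Matrix.scalar κ t - -B) i := by
    ext j j'
    simp [hE, B, LinearMap.funLeft_apply, Matrix.scalar_apply, Matrix.diagonal_apply,
      Pi.single_apply, add_comm, eq_comm]
  rw [hcomp]
  exact hrow

/-- The coordinates of `x` along the vectors `b a`. -/
def coords {m M : ℕ} (b : Fin M → EuclideanSpace ℝ (Fin m)) (x : Fin m → ℝ) : Fin M → ℝ :=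
  fun a => inner ℝ (b a) (WithLp.toLp 2 x)

lemma continuous_coords {m M : ℕ} (b : Fin M → EuclideanSpace ℝ (Fin m)) :
    Continuous (coords b) := by
  unfold coords
  fun_prop

lemma charFun_gauss (σ : ℝ≥0) {m : ℕ} (t : EuclideanSpace ℝ (Fin m)) :
    charFun ((gauss σ m).map (WithLp.toLp 2)) t = Complex.exp (-(σ * ‖t‖ ^ 2 / 2 : ℝ)) := by
  rw [charFun_pi]
  simp_rw [charFun_gaussianReal, ← Complex.exp_sum, EuclideanSpace.real_norm_sq_eq]
  congr 1
  push_cast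
  rw [Finset.mul_sum, Finset.sum_div, ← Finset.sum_neg_distrib]
  exact Finset.sum_congr rfl fun i _ => by simp

/-- Orthonormal coordinates of a standard Gaussian vector are again standard Gaussian. -/
lemma measurePreserving_coords (σ : ℝ≥0) {m M : ℕ} {b : Fin M → EuclideanSpace ℝ (Fin m)}
    (hb : Orthonormal ℝ b) : MeasurePreserving (coords b) (gauss σ m) (gauss σ M) := by
  have hm := (continuous_coords b).measurable
  refine ⟨hm, ?_⟩
  have : IsProbabilityMeasure ((gauss σ m).map (coords b)) :=
    Measure.isProbabilityMeasure_map hm.aemeasurable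
  refine charFun_eq_pi_iff.1 fun t => ?_
  -- The adjoint of the coordinate map sends `t` to `∑ a, t a • b a`, which has the norm of `t` by
  -- orthonormality; Gaussian characteristic functions see only that norm.
  have h1 : charFun (((gauss σ m).map (coords b)).map (WithLp.toLp 2)) t =
      charFun ((gauss σ m).map (WithLp.toLp 2)) (∑ a, t a • b a) := by
    simp only [charFun, ← MeasurableEquiv.coe_toLp, integral_map_equiv]
    rw [integral_map hm.aemeasurable (by fun_prop)]
    congr 1
    ext x
    congr 3
    simp [inner_sum, inner_smul_right, PiLp.inner_apply, coords, mul_comm]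
  rw [h1, charFun_gauss, ← charFun_pi, charFun_gauss]
  have h2 : ‖∑ a, t a • b a‖ ^ 2 = ‖t‖ ^ 2 := by
    rw [← real_inner_self_eq_norm_sq, hb.inner_sum, EuclideanSpace.real_norm_sq_eq]
    simp [sq]
  rw [h2]

/-- Parseval's identity in `V`, combined with self-adjointness and idempotence of the projection. -/
lemma coords_dotProduct {m : ℕ} (V : Submodule ℝ (EuclideanSpace ℝ (Fin m)))
    {M : ℕ} (b : OrthonormalBasis (Fin M) ℝ V) (x y : Fin m → ℝ) :
    coords (fun a => (b a : EuclideanSpace ℝ (Fin m))) x ⬝ᵥ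
      coords (fun a => (b a : EuclideanSpace ℝ (Fin m))) y =
      inner ℝ (V.starProjection (WithLp.toLp 2 x)) (WithLp.toLp 2 y) := by
  have h : ∀ (z : EuclideanSpace ℝ (Fin m)) (a : Fin M),
      inner ℝ (b a : EuclideanSpace ℝ (Fin m)) z =
      inner ℝ (b a) (V.orthogonalProjectionOnto z) := fun z a => by
    rw [Submodule.coe_inner, ← Submodule.starProjection_apply,
      ← Submodule.inner_starProjection_left_eq_right,
      Submodule.starProjection_eq_self_iff.2 (b a).2]
  have h2 := b.sum_inner_mul_inner (V.orthogonalProjectionOnto (WithLp.toLp 2 x))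
    (V.orthogonalProjectionOnto (WithLp.toLp 2 y))
  rw [Submodule.coe_inner, ← Submodule.starProjection_apply, ← Submodule.starProjection_apply,
    ← Submodule.inner_starProjection_left_eq_right,
    Submodule.starProjection_eq_self_iff.2 (Submodule.starProjection_apply_mem _ _)] at h2
  rw [← h2]
  simp only [dotProduct, coords, h]
  exact Finset.sum_congr rfl fun a _ => by rw [real_inner_comm]

/-! ### Projection energies: increments and measurability. -/

/-- One Gram–Schmidt step: only the component `q` of `w` orthogonal to `W` contributes a new
direction. If `w ∈ W`, the quotient is `0 / 0 = 0`, as it should be. -/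
lemma norm_sq_starProjection_sup_span {E : Type*} [NormedAddCommGroup E] [InnerProductSpace ℝ E]
    [FiniteDimensional ℝ E] (W : Submodule ℝ E) (w y : E) :
    ‖(W ⊔ Submodule.span ℝ {w}).starProjection y‖ ^ 2 = ‖W.starProjection y‖ ^ 2 +
      inner ℝ (Wᗮ.starProjection w) y ^ 2 / inner ℝ (Wᗮ.starProjection w) w := by
  set q := Wᗮ.starProjection w with hq
  have hqW : q ∈ Wᗮ := Submodule.starProjection_apply_mem _ _
  have hqq : inner ℝ q w = ‖q‖ ^ 2 := by
    rw [← real_inner_self_eq_norm_sq, hq, Submodule.inner_starProjection_left_eq_right,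
      Submodule.inner_starProjection_left_eq_right,
      Submodule.starProjection_eq_self_iff.2 (Submodule.starProjection_apply_mem _ _)]
  have hqw : q = w - W.starProjection w := Submodule.starProjection_orthogonal_val w
  set c := inner ℝ q y / ‖q‖ ^ 2 with hc
  have hcq : c * ‖q‖ ^ 2 = inner ℝ q y := by
    by_cases h : q = 0
    · simp [h]
    · rw [hc, div_mul_cancel₀]
      simpa using h
  have hproj : (W ⊔ Submodule.span ℝ {w}).starProjection y = W.starProjection y + c • q := by
    refine Submodule.eq_starProjection_of_mem_of_inner_eq_zero ?_ ?_
    · refine add_mem (Submodule.mem_sup_left (Submodule.starProjection_apply_mem _ _))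
        (Submodule.smul_mem _ _ ?_)
      rw [hqw]
      exact sub_mem (Submodule.mem_sup_right (Submodule.mem_span_singleton_self w))
        (Submodule.mem_sup_left (Submodule.starProjection_apply_mem _ _))
    · have h1 : ∀ u ∈ W, inner ℝ (y - (W.starProjection y + c • q)) u = 0 := by
        intro u hu
        rw [← sub_sub, inner_sub_left, Submodule.starProjection_inner_eq_zero _ _ hu,
          inner_smul_left, real_inner_comm, hqW u hu]
        simp
      have h2 : inner ℝ (y - (W.starProjection y + c • q)) w = 0 := by
        have hw : w = q + W.starProjection w := by rw [hqw]; abel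
        rw [hw, inner_add_right, h1 _ (Submodule.starProjection_apply_mem _ _), add_zero,
          inner_sub_left, inner_add_left, inner_smul_left, real_inner_self_eq_norm_sq,
          hqW _ (Submodule.starProjection_apply_mem _ _), real_inner_comm]
        simp only [conj_trivial]
        linarith
      intro u hu
      obtain ⟨u1, hu1, u2, hu2, rfl⟩ := Submodule.mem_sup.1 hu
      obtain ⟨r, rfl⟩ := Submodule.mem_span_singleton.1 hu2
      rw [inner_add_right, inner_smul_right, h1 _ hu1, h2]
      simp
  rw [hproj, hqq, ← real_inner_self_eq_norm_sq, inner_add_left, inner_add_right, inner_add_right,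
    real_inner_self_eq_norm_sq, inner_smul_left, inner_smul_left, inner_smul_right,
    inner_smul_right, real_inner_self_eq_norm_sq, real_inner_comm (W.starProjection y) q,
    hqW _ (Submodule.starProjection_apply_mem _ _)]
  simp only [conj_trivial, mul_zero, add_zero, zero_add]
  rw [hcq, hc]
  ring

/-- Adding a column to an index set increases the energy by the score of the column in
orthonormal coordinates of the orthogonal complement. -/
lemma energy_insert {m n : ℕ} (A : Fin m → Fin n → ℝ) (y : Fin m → ℝ) (K : Finset (Fin n))
    (j : Fin n) {W : Submodule ℝ (EuclideanSpace ℝ (Fin m))} (hW : colSpan A K = W) {M : ℕ}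
    (b : OrthonormalBasis (Fin M) ℝ Wᗮ) :
    energy A (WithLp.toLp 2 y) (insert j K) = energy A (WithLp.toLp 2 y) K +
      score (coords (fun a => (b a : EuclideanSpace ℝ (Fin m))) fun i => A i j)
        (coords (fun a => (b a : EuclideanSpace ℝ (Fin m))) y) := by
  subst hW
  have hspan : colSpan A (insert j K) =
      colSpan A K ⊔ Submodule.span ℝ {WithLp.toLp 2 fun i => A i j} := by
    rw [colSpan, Finset.coe_insert, Set.image_insert_eq, Submodule.span_insert, sup_comm]
    rfl
  have key : ∀ W, W = colSpan A K ⊔ Submodule.span ℝ {WithLp.toLp 2 fun i => A i j} →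
      ‖W.starProjection (WithLp.toLp 2 y)‖ ^ 2 =
        ‖(colSpan A K).starProjection (WithLp.toLp 2 y)‖ ^ 2 +
          inner ℝ ((colSpan A K)ᗮ.starProjection (WithLp.toLp 2 fun i => A i j))
            (WithLp.toLp 2 y) ^ 2 /
          inner ℝ ((colSpan A K)ᗮ.starProjection (WithLp.toLp 2 fun i => A i j))
            (WithLp.toLp 2 fun i => A i j) := by
    rintro _ rfl
    exact norm_sq_starProjection_sup_span _ _ _
  simp only [energy, score, coords_dotProduct]
  exact key _ hspan

/-- The energy is the maximum of `2⟨w, y⟩ - ‖w‖²` over the span, attained at the projection. As a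
supremum of functions continuous in `(A, y)` it is lower semicontinuous, hence measurable without
any discussion of rank. -/
lemma lt_energy_iff {m n : ℕ} (A : Fin m → Fin n → ℝ) (y : EuclideanSpace ℝ (Fin m))
    (J : Finset (Fin n)) (t : ℝ) :
    t < energy A y J ↔ ∃ c : Fin n → ℝ,
      t < 2 * inner ℝ (∑ j ∈ J, c j • WithLp.toLp 2 fun i => A i j) y -
        ‖∑ j ∈ J, c j • (WithLp.toLp 2 fun i => A i j : EuclideanSpace ℝ (Fin m))‖ ^ 2 := by
  set p := (colSpan A J).starProjection y with hp
  constructor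
  · intro h
    have hmem : p ∈ colSpan A J := Submodule.starProjection_apply_mem _ _
    rw [colSpan, Submodule.mem_span_image_finset_iff_exists_fun'] at hmem
    obtain ⟨c, hc⟩ := hmem
    refine ⟨c, ?_⟩
    rw [hc]
    have : inner ℝ p y = ‖p‖ ^ 2 := by
      rw [← real_inner_self_eq_norm_sq, hp, Submodule.inner_starProjection_left_eq_right,
        Submodule.inner_starProjection_left_eq_right,
        Submodule.starProjection_eq_self_iff.2 (Submodule.starProjection_apply_mem _ _)]
    rw [this]
    have : energy A y J = ‖p‖ ^ 2 := rfl
    linarith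
  · rintro ⟨c, hc⟩
    refine hc.trans_le ?_
    set w := ∑ j ∈ J, c j • (WithLp.toLp 2 fun i => A i j : EuclideanSpace ℝ (Fin m)) with hw
    have hmem : w ∈ colSpan A J :=
      sum_mem fun j hj => Submodule.smul_mem _ _ (Submodule.subset_span ⟨j, hj, rfl⟩)
    have : inner ℝ w y = inner ℝ w p := by
      rw [hp, ← Submodule.inner_starProjection_left_eq_right,
        Submodule.starProjection_eq_self_iff.2 hmem]
    rw [this]
    have h1 := norm_sub_sq_real w p
    have h2 : 0 ≤ ‖w - p‖ ^ 2 := by positivity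
    have : energy A y J = ‖p‖ ^ 2 := rfl
    linarith

lemma measurable_energy {m n : ℕ} (J : Finset (Fin n)) :
    Measurable fun q : (Fin m → Fin n → ℝ) × EuclideanSpace ℝ (Fin m) => energy q.1 q.2 J := by
  refine measurable_of_Ioi fun t => IsOpen.measurableSet ?_
  have : (fun q : (Fin m → Fin n → ℝ) × EuclideanSpace ℝ (Fin m) => energy q.1 q.2 J) ⁻¹'
      Set.Ioi t = ⋃ c : Fin n → ℝ, {q |
        t < 2 * inner ℝ (∑ j ∈ J, c j • WithLp.toLp 2 fun i => q.1 i j) q.2 -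
        ‖∑ j ∈ J, c j • (WithLp.toLp 2 fun i => q.1 i j : EuclideanSpace ℝ (Fin m))‖ ^ 2} := by
    ext q
    simp only [Set.mem_preimage, Set.mem_Ioi, Set.mem_iUnion, Set.mem_ofPred_eq]
    exact lt_energy_iff q.1 q.2 J t
  rw [this]
  refine isOpen_iUnion fun c => isOpen_lt continuous_const ?_
  fun_prop

/-! ### Conditioning on the columns in `K`. -/

lemma measurable_obs {m n : ℕ} (x : EuclideanSpace ℝ (Fin n)) :
    Measurable fun ω : Sample m n => (ω.1, obs x ω) := by
  refine Continuous.measurable ?_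
  unfold obs signal Matrix.mulVec dotProduct
  fun_prop

/-- Assemble a sample from the columns in `K`, the other columns and the noise. -/
def assemble {m n : ℕ} (K : Finset (Fin n))
    (q : ({j // j ∈ K} → Fin m → ℝ) × ({j // j ∉ K} → Fin m → ℝ) × (Fin m → ℝ)) : Sample m n :=
  (fun i j => (if h : j ∈ K then q.1 ⟨j, h⟩ else q.2.1 ⟨j, h⟩) i, q.2.2)

lemma measurePreserving_transpose (m n : ℕ) :
    MeasurePreserving
      (fun q : (Fin n → Fin m → ℝ) × (Fin m → ℝ) => ((fun i j => q.1 j i, q.2) : Sample m n))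
      ((Measure.pi fun _ : Fin n => gauss (1 / m) m).prod (gauss 1 m)) (law m n) :=
  (measurePreserving_swap (gaussianReal 0 (1 / m))).prod (MeasurePreserving.id _)

lemma measurePreserving_assemble {m n : ℕ} (K : Finset (Fin n)) :
    MeasurePreserving (assemble (m := m) K)
      ((Measure.pi fun _ : {j // j ∈ K} => gauss (1 / m) m).prod
        ((Measure.pi fun _ : {j // j ∉ K} => gauss (1 / m) m).prod (gauss 1 m))) (law m n) := by
  have h1 : MeasurePreserving (MeasurableEquiv.prodAssoc.symm)
      ((Measure.pi fun _ : {j // j ∈ K} => gauss (1 / m) m).prod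
        ((Measure.pi fun _ : {j // j ∉ K} => gauss (1 / m) m).prod (gauss 1 m)))
      (((Measure.pi fun _ : {j // j ∈ K} => gauss (1 / m) m).prod
        (Measure.pi fun _ : {j // j ∉ K} => gauss (1 / m) m)).prod (gauss 1 m)) :=
    MeasurePreserving.symm MeasurableEquiv.prodAssoc
      ⟨MeasurableEquiv.measurable _, Measure.prodAssoc_prod⟩
  have h2 := ((measurePreserving_piEquivPiSubtypeProd
    (fun _ : Fin n => gauss (1 / m) m) (· ∈ K)).symm _).prod (MeasurePreserving.id (gauss 1 m))
  rw [Subsingleton.elim (Subtype.fintype fun x => x ∈ K) (Finset.Subtype.fintype K)] at h2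
  exact (measurePreserving_transpose m n).comp (h2.comp h1)

lemma obs_eq_sum {m n : ℕ} (x : EuclideanSpace ℝ (Fin n)) (ω : Sample m n) :
    obs x ω = ∑ j, x j • WithLp.toLp 2 (fun i => ω.1 i j) + WithLp.toLp 2 ω.2 := by
  ext i
  simp [obs, signal, Matrix.mulVec, dotProduct, mul_comm]

/-- The complement annihilates the columns in `K`, and outside `K` only entry `i` of `x` survives.
-/
lemma coords_obs {m n : ℕ} {x : EuclideanSpace ℝ (Fin n)} {K : Finset (Fin n)} {i : Fin n}
    (hx : ∀ j, j ∉ K → j ≠ i → x j = 0) (ω : Sample m n)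
    {W : Submodule ℝ (EuclideanSpace ℝ (Fin m))} (hW : colSpan ω.1 K = W) {M : ℕ}
    (b : Fin M → Wᗮ) :
    coords (fun a => (b a : EuclideanSpace ℝ (Fin m))) (obs x ω).ofLp =
      fun a => x i * coords (fun a => (b a : EuclideanSpace ℝ (Fin m))) (fun l => ω.1 l i) a +
        coords (fun a => (b a : EuclideanSpace ℝ (Fin m))) ω.2 a := by
  ext a
  have h0 : ∀ j ∈ K, inner ℝ (b a : EuclideanSpace ℝ (Fin m))
      (WithLp.toLp 2 fun l => ω.1 l j) = 0 := by
    intro j hj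
    rw [real_inner_comm]
    exact (b a).2 _ (hW ▸ Submodule.subset_span ⟨j, hj, rfl⟩)
  simp only [coords, WithLp.toLp_ofLp]
  rw [obs_eq_sum, inner_add_right, inner_sum, Finset.sum_eq_single i]
  · rw [inner_smul_right]
  · intro j _ hj
    rw [inner_smul_right]
    by_cases hjK : j ∈ K
    · rw [h0 j hjK, mul_zero]
    · rw [hx j hjK hj, zero_mul]
  · simp

lemma colSpan_assemble {m n : ℕ} (K : Finset (Fin n)) (g : {j // j ∈ K} → Fin m → ℝ)
    (q : ({j // j ∉ K} → Fin m → ℝ) × (Fin m → ℝ)) :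
    colSpan (assemble K (g, q)).1 K =
      Submodule.span ℝ (Set.range fun j => (WithLp.toLp 2 (g j) : EuclideanSpace ℝ (Fin m))) := by
  unfold colSpan
  congr 1
  ext v
  constructor
  · rintro ⟨j, hj, rfl⟩
    have hj' : j ∈ K := hj
    exact ⟨⟨j, hj'⟩, by simp [assemble, hj']⟩
  · rintro ⟨⟨j, hj⟩, rfl⟩
    exact ⟨j, hj, by simp [assemble, hj]⟩

lemma ae_finrank_orthogonal_span {ι : Type*} [Fintype ι] {σ : ℝ≥0} (hσ : σ ≠ 0) (m : ℕ) :
    ∀ᵐ g ∂Measure.pi (fun _ : ι => gauss σ m),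
      Module.finrank ℝ (Submodule.span ℝ (Set.range fun j =>
        (WithLp.toLp 2 (g j) : EuclideanSpace ℝ (Fin m))))ᗮ = m - Fintype.card ι := by
  -- Taking the minimum also covers more columns than dimensions: the complement is then zero, in
  -- agreement with truncated subtraction.
  obtain ⟨r, hr⟩ : ∃ r, r = min m (Fintype.card ι) := ⟨_, rfl⟩
  have h : Fin r ↪ ι := (Fin.castLEEmb (by omega)).trans (Fintype.equivFin ι).symm.toEmbedding
  filter_upwards [ae_linearIndependent hσ h (m := m) (by simp [hr])] with g hg
  set f : ι → EuclideanSpace ℝ (Fin m) := fun j => WithLp.toLp 2 (g j)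
  have hlin : LinearIndependent ℝ (f ∘ h) :=
    hg.map' (WithLp.linearEquiv 2 ℝ (Fin m → ℝ)).symm.toLinearMap (LinearEquiv.ker _)
  have h1 : r ≤ Module.finrank ℝ (Submodule.span ℝ (Set.range f)) := by
    have := finrank_span_eq_card hlin
    rw [Fintype.card_fin] at this
    rw [← this]
    exact Submodule.finrank_mono (Submodule.span_mono (Set.range_comp_subset_range h f))
  have h2 : Module.finrank ℝ (Submodule.span ℝ (Set.range f)) ≤ Fintype.card ι :=
    finrank_range_le_card f
  have h3 := Submodule.finrank_add_finrank_orthogonal (Submodule.span ℝ (Set.range f))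
  rw [finrank_euclideanSpace, Fintype.card_fin] at h3
  have arith : ∀ a c : ℕ, r ≤ a → a ≤ Fintype.card ι → a + c = m → c = m - Fintype.card ι := by
    intro a c _ _ _
    omega
  exact arith _ _ h1 h2 h3

lemma measurable_energy_obs {m n : ℕ} (x : EuclideanSpace ℝ (Fin n)) (J : Finset (Fin n)) :
    Measurable fun ω : Sample m n => energy ω.1 (obs x ω) J :=
  Measurable.comp (g := fun q : (Fin m → Fin n → ℝ) × EuclideanSpace ℝ (Fin m) => energy q.1 q.2 J)
    (f := fun ω : Sample m n => (ω.1, obs x ω)) (measurable_energy J) (measurable_obs x)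

lemma measurable_score_shift {ι : Type*} {M : ℕ} (v : ℝ) (i l : ι) :
    Measurable fun p : (ι → Fin M → ℝ) × (Fin M → ℝ) =>
      score (p.1 l) (fun a => v * p.1 i a + p.2 a) := by
  unfold score dotProduct
  fun_prop

/-- Conditioning on the columns in `K`: comparing the energies of the sets `insert j K` is a test
between single columns in dimension `m - |K|`. -/
theorem law_energy_insert_le {m n : ℕ} (hm : 0 < m) {x : EuclideanSpace ℝ (Fin n)}
    {K : Finset (Fin n)} {i : Fin n} (hi : i ∉ K) (hx : ∀ j, j ∉ K → j ≠ i → x j = 0)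
    {R : ℝ → ℝ → Prop} (hR : MeasurableSet {p : ℝ × ℝ | R p.1 p.2})
    (hRadd : ∀ e a b, R (e + a) (e + b) → R a b) {B : ℝ≥0∞}
    (hB : ((Measure.pi fun _ : {j // j ∉ K} => gauss (1 / m) (m - K.card)).prod
        (gauss 1 (m - K.card)))
        {p | ∀ l, l ≠ ⟨i, hi⟩ → R (score (p.1 l) (fun a => x i * p.1 ⟨i, hi⟩ a + p.2 a))
          (score (p.1 ⟨i, hi⟩) (fun a => x i * p.1 ⟨i, hi⟩ a + p.2 a))} ≤ B) :
    law m n {ω | ∀ j, j ∉ K → j ≠ i →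
      R (energy ω.1 (obs x ω) (insert j K)) (energy ω.1 (obs x ω) (insert i K))} ≤ B := by
  have hσ : (1 / m : ℝ≥0) ≠ 0 := by positivity
  set S : Set (Sample m n) := {ω | ∀ j, j ∉ K → j ≠ i →
      R (energy ω.1 (obs x ω) (insert j K)) (energy ω.1 (obs x ω) (insert i K))} with hSdef
  have hen := measurable_energy_obs (m := m) x
  have hS : MeasurableSet S := by
    simp only [hSdef, Set.ofPred_forall]
    refine MeasurableSet.iInter fun j => MeasurableSet.iInter fun _ =>
      MeasurableSet.iInter fun _ => ?_
    exact ((hen (insert j K)).prodMk (hen (insert i K))) hR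
  set M := m - K.card with hM
  set F : Set (({j // j ∉ K} → Fin M → ℝ) × (Fin M → ℝ)) := {p | ∀ l, l ≠ ⟨i, hi⟩ →
    R (score (p.1 l) (fun a => x i * p.1 ⟨i, hi⟩ a + p.2 a))
      (score (p.1 ⟨i, hi⟩) (fun a => x i * p.1 ⟨i, hi⟩ a + p.2 a))} with hFdef
  have hF : MeasurableSet F := by
    have hsc := measurable_score_shift (M := M) (x i) (⟨i, hi⟩ : {j // j ∉ K})
    simp only [hFdef, Set.ofPred_forall]
    refine MeasurableSet.iInter fun l => MeasurableSet.iInter fun _ => ?_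
    exact ((hsc l).prodMk (hsc ⟨i, hi⟩)) hR
  rw [← (measurePreserving_assemble K).measure_preimage hS.nullMeasurableSet,
    Measure.prod_apply ((measurePreserving_assemble K).measurable hS)]
  have hae : ∀ᵐ g ∂Measure.pi (fun _ : {j // j ∈ K} => gauss (1 / m) m),
      ((Measure.pi fun _ : {j // j ∉ K} => gauss (1 / m) m).prod (gauss 1 m))
        (Prod.mk g ⁻¹' (assemble K ⁻¹' S)) ≤ B := by
    filter_upwards [ae_finrank_orthogonal_span (ι := {j // j ∈ K}) hσ m] with g hg
    rw [Fintype.card_coe, ← hM] at hg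
    set W := Submodule.span ℝ (Set.range fun j => (WithLp.toLp 2 (g j) : EuclideanSpace ℝ (Fin m)))
    let b : OrthonormalBasis (Fin M) ℝ Wᗮ := (stdOrthonormalBasis ℝ Wᗮ).reindex (finCongr hg)
    let v : Fin M → EuclideanSpace ℝ (Fin m) := fun a => b a
    have hv : Orthonormal ℝ v := b.orthonormal.comp_linearIsometry Wᗮ.subtypeₗᵢ
    have hmp : MeasurePreserving (Prod.map (fun (h : {j // j ∉ K} → Fin m → ℝ) j => coords v (h j))
        (coords v))
        ((Measure.pi fun _ : {j // j ∉ K} => gauss (1 / m) m).prod (gauss 1 m))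
        ((Measure.pi fun _ : {j // j ∉ K} => gauss (1 / m) M).prod (gauss 1 M)) :=
      (measurePreserving_pi _ _ fun _ => measurePreserving_coords _ hv).prod
        (measurePreserving_coords _ hv)
    refine le_trans ?_ hB
    rw [← hmp.measure_preimage hF.nullMeasurableSet]
    refine measure_mono ?_
    intro q hq l hl
    have hW := colSpan_assemble K g q
    have h1 := hq l l.2 fun h => hl (Subtype.ext h)
    have h2 := fun j => energy_insert (assemble K (g, q)).1 (obs x (assemble K (g, q))).ofLp K j hW b
    simp only [WithLp.toLp_ofLp] at h2
    rw [h2, h2] at h1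
    -- The energy of `K` is common to both sides and cancels, leaving the scores.
    have h3 := hRadd _ _ _ h1
    rw [coords_obs hx _ hW b] at h3
    have hcol : ∀ j : {j // j ∉ K}, (fun l => (assemble K (g, q)).1 l j) = q.1 j := by
      intro j
      ext l
      simp [assemble, j.2]
    rw [hcol l, hcol ⟨i, hi⟩] at h3
    exact h3
  refine (lintegral_mono_ae hae).trans ?_
  simp

/-! ### The quantitative bound on success. -/

/-- The bound on the probability of success, as a function of `L = log (n - k)`. -/
def successBound (δ L : ℝ) : ℝ≥0∞ := ENNReal.ofReal (Real.exp (-(δ / 4 * L)) + 32 / (δ ^ 2 * L))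

lemma tendsto_successBound {δ : ℝ} (hδ : 0 < δ) :
    Tendsto (successBound δ) atTop (𝓝 0) := by
  have h1 : Tendsto (fun L : ℝ => Real.exp (-(δ / 4 * L))) atTop (𝓝 0) :=
    Real.tendsto_exp_neg_atTop_nhds_zero.comp (tendsto_id.const_mul_atTop (by positivity))
  have h2 : Tendsto (fun L : ℝ => 32 / (δ ^ 2 * L)) atTop (𝓝 0) :=
    tendsto_const_nhds.div_atTop (tendsto_id.const_mul_atTop (by positivity))
  have := (ENNReal.continuous_ofReal.tendsto _).comp (h1.add h2)
  rw [add_zero, ENNReal.ofReal_zero] at this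
  exact this

/-- The threshold `(1 - δ / 4) * L` exceeds the mean bound `X / 2` by at least `δ L / 4`, which
serves Chebyshev, and lies `δ L / 4` below `L`, which beats the number `N` of candidates. -/
lemma le_successBound {δ L X : ℝ} (hδ : 0 < δ) (hL : 0 < L)
    (hX : X ≤ (2 - δ) * L) :
    X / 2 < (1 - δ / 4) * L ∧ ∀ N : ℝ≥0∞, ENNReal.ofReal (Real.exp L) ≤ N →
      ENNReal.ofReal (Real.exp ((1 - δ / 4) * L)) * N⁻¹ +
        ENNReal.ofReal (X / ((1 - δ / 4) * L - X / 2) ^ 2) ≤ successBound δ L := by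
  have hδL : 0 < δ * L := mul_pos hδ hL
  have hgap : δ / 4 * L ≤ (1 - δ / 4) * L - X / 2 := by linarith
  refine ⟨by linarith, fun N hN => ?_⟩
  rw [successBound, ENNReal.ofReal_add (by positivity) (by positivity)]
  refine add_le_add ?_ (ENNReal.ofReal_le_ofReal ?_)
  · have h1 : N⁻¹ ≤ (ENNReal.ofReal (Real.exp L))⁻¹ := ENNReal.inv_le_inv.2 hN
    refine (mul_le_mul_right h1 _).trans ?_
    rw [← ENNReal.ofReal_inv_of_pos (Real.exp_pos _), ← Real.exp_neg,
      ← ENNReal.ofReal_mul (Real.exp_pos _).le, ← Real.exp_add]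
    exact ENNReal.ofReal_le_ofReal (Real.exp_le_exp.2 (by linarith))
  · calc X / ((1 - δ / 4) * L - X / 2) ^ 2 ≤ (2 * L) / (δ / 4 * L) ^ 2 := by
          gcongr
          nlinarith
      _ = 32 / (δ ^ 2 * L) := by
          field_simp
          ring

/-! ### Closed forms of SNR and MAR. -/

lemma memLp_sum_mul_gauss (σ : ℝ≥0) {n : ℕ} (x : Fin n → ℝ) :
    MemLp (fun r : Fin n → ℝ => ∑ j, r j * x j) 2 (gauss σ n) := by
  refine memLp_finsetSum _ fun j _ => ?_
  have h : MemLp (fun t : ℝ => t * x j) 2 (gaussianReal 0 σ) :=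
    (memLp_id_gaussianReal' 2 (by simp)).mul_const (x j)
  exact h.comp_measurePreserving (measurePreserving_eval (fun _ => gaussianReal 0 σ) j)

lemma integral_sum_mul_sq_gauss (σ : ℝ≥0) {n : ℕ} (x : Fin n → ℝ) :
    ∫ r, (∑ j, r j * x j) ^ 2 ∂gauss σ n = σ * ∑ j, x j ^ 2 := by
  have hmem : ∀ j : Fin n, MemLp (fun t : ℝ => t * x j) 2 (gaussianReal 0 σ) := fun j =>
    (memLp_id_gaussianReal' 2 (by simp)).mul_const (x j)
  have h1 := variance_sum_pi (μ := fun _ : Fin n => gaussianReal 0 σ)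
    (X := fun j (t : ℝ) => t * x j) hmem
  have hfun : (∑ j, fun r : Fin n → ℝ => r j * x j) = fun r => ∑ j, r j * x j := by
    ext r; simp
  have hmean : ∫ r, ∑ j, r j * x j ∂gauss σ n = 0 := by
    rw [integral_finsetSum]
    · refine Finset.sum_eq_zero fun j _ => ?_
      rw [integral_mul_const, integral_comp_eval (μ := fun _ : Fin n => gaussianReal 0 σ) (i := j)
        (f := fun t : ℝ => t) (by fun_prop), integral_id_gaussianReal, zero_mul]
    · intro j _
      exact ((hmem j).comp_measurePreserving (measurePreserving_eval _ j)).integrable one_le_two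
  rw [hfun, variance_of_integral_eq_zero (Measurable.aemeasurable (by fun_prop)) hmean] at h1
  rw [h1, Finset.mul_sum]
  refine Finset.sum_congr rfl fun j _ => ?_
  have h2 : Var[fun t : ℝ => t * x j; gaussianReal 0 σ] =
      Var[fun t : ℝ => t; gaussianReal 0 σ] * x j ^ 2 := variance_mul_const _ _ _
  rw [h2, variance_fun_id_gaussianReal]

lemma integral_norm_signal_sq {m n : ℕ} (hm : 0 < m) (x : EuclideanSpace ℝ (Fin n)) :
    ∫ ω, ‖signal ω.1 x‖ ^ 2 ∂law m n = ‖x‖ ^ 2 := by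
  have hm' : (m : ℝ) ≠ 0 := by positivity
  rw [law, integral_fun_fst (fun A : Fin m → Fin n → ℝ => ‖signal A x‖ ^ 2)]
  have h : ∀ A : Fin m → Fin n → ℝ, ‖signal A x‖ ^ 2 = ∑ i, (∑ j, A i j * x j) ^ 2 := by
    intro A
    rw [EuclideanSpace.real_norm_sq_eq]
    rfl
  simp only [h, probReal_univ, one_smul]
  rw [integral_finsetSum]
  · have hi : ∀ i : Fin m, ∫ A : Fin m → Fin n → ℝ, (∑ j, A i j * x j) ^ 2
        ∂(Measure.pi fun _ : Fin m => gauss (1 / m) n) = (1 / m : ℝ≥0) * ∑ j, x j ^ 2 := by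
      intro i
      rw [integral_comp_eval (μ := fun _ : Fin m => gauss (1 / m) n) (i := i)
        (f := fun r : Fin n → ℝ => (∑ j, r j * x j) ^ 2)
        (Measurable.aestronglyMeasurable (by fun_prop)), integral_sum_mul_sq_gauss]
    rw [Finset.sum_congr rfl fun i _ => hi i, ← EuclideanSpace.real_norm_sq_eq]
    simp only [Finset.sum_const, Finset.card_univ, Fintype.card_fin, nsmul_eq_mul]
    push_cast
    field_simp
  · intro i _
    exact ((memLp_sum_mul_gauss (1 / m) x.ofLp).comp_measurePreserving
      (measurePreserving_eval (fun _ : Fin m => gauss (1 / m) n) i)).integrable_sq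

lemma integral_norm_noise_sq (m n : ℕ) :
    ∫ ω, ‖(WithLp.toLp 2 ω.2 : EuclideanSpace ℝ (Fin m))‖ ^ 2 ∂law m n = m := by
  rw [law, integral_fun_snd
    (fun d : Fin m → ℝ => ‖(WithLp.toLp 2 d : EuclideanSpace ℝ (Fin m))‖ ^ 2)]
  simp only [EuclideanSpace.real_norm_sq_eq, probReal_univ, one_smul]
  rw [integral_finsetSum]
  · rw [Finset.sum_congr rfl fun i _ =>
      (integral_comp_eval (μ := fun _ : Fin m => gaussianReal 0 1) (i := i)
        (f := fun t : ℝ => t ^ 2) (by fun_prop))]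
    simp [integral_sq_gaussianReal]
  · intro i _
    exact (measurePreserving_eval (fun _ : Fin m => gaussianReal 0 1) i).integrable_comp_of_integrable
      (integrable_pow_gaussianReal 1 2)

lemma SNR_eq {m n : ℕ} (hm : 0 < m) (x : EuclideanSpace ℝ (Fin n)) : SNR m x = ‖x‖ ^ 2 / m := by
  rw [SNR, integral_norm_signal_sq hm, integral_norm_noise_sq]

lemma mem_pattern {n : ℕ} {x : EuclideanSpace ℝ (Fin n)} {j : Fin n} :
    j ∈ pattern x ↔ x j ≠ 0 := by
  simp [pattern]

lemma MAR_eq {n : ℕ} {x : EuclideanSpace ℝ (Fin n)} {i : Fin n} (hi : i ∈ pattern x)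
    (hmin : ∀ j ∈ pattern x, |x i| ^ 2 ≤ |x j| ^ 2) :
    MAR x = x i ^ 2 / (‖x‖ ^ 2 / (pattern x).card) := by
  have : Nonempty (pattern x) := ⟨⟨i, hi⟩⟩
  rw [MAR]
  congr 1
  rw [← sq_abs (x i)]
  refine le_antisymm ?_ (le_ciInf fun j => hmin j j.2)
  exact ciInf_le (f := fun j : pattern x => |x j| ^ 2) ⟨0, by rintro _ ⟨j, rfl⟩; positivity⟩ ⟨i, hi⟩

lemma exists_min_pattern {n : ℕ} {x : EuclideanSpace ℝ (Fin n)} (h : 0 < (pattern x).card) :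
    ∃ i ∈ pattern x, ∀ j ∈ pattern x, |x i| ^ 2 ≤ |x j| ^ 2 :=
  Finset.exists_min_image _ _ (Finset.card_pos.1 h)

/-- The norm of `x` cancels: MAR times SNR, divided by `k`, is the signal-to-noise ratio `x i ^ 2 /
m` of the weakest column. -/
lemma MAR_mul_SNR_eq {m n : ℕ} (hm : 0 < m) {x : EuclideanSpace ℝ (Fin n)} {i : Fin n}
    (hi : i ∈ pattern x) (hmin : ∀ j ∈ pattern x, |x i| ^ 2 ≤ |x j| ^ 2) :
    MAR x * SNR m x = (pattern x).card * x i ^ 2 / m := by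
  have hx : ‖x‖ ≠ 0 := by
    rw [norm_ne_zero_iff]
    rintro rfl
    simp [mem_pattern] at hi
  have hc : ((pattern x).card : ℝ) ≠ 0 := by
    have := Finset.card_pos.2 ⟨i, hi⟩
    positivity
  rw [MAR_eq hi hmin, SNR_eq hm]
  field_simp

/-- The dimension condition in terms of the smallest nonzero entry. -/
lemma dimension_condition {m n : ℕ} (hm : 0 < m) {x : EuclideanSpace ℝ (Fin n)} {i : Fin n}
    (hi : i ∈ pattern x) (hmin : ∀ j ∈ pattern x, |x i| ^ 2 ≤ |x j| ^ 2) {δ L : ℝ}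
    (hL : 0 < L)
    (h : (m : ℝ) < (2 - δ) / (MAR x * SNR m x) * (pattern x).card * L + (pattern x).card - 1) :
    ((m - (pattern x).card + 1 : ℝ)) * (x i ^ 2 * (1 / m : ℝ≥0)) ≤ (2 - min δ 1) * L := by
  have hx : 0 < x i ^ 2 := by
    have := mem_pattern.1 hi
    positivity
  have hc : (0 : ℝ) < (pattern x).card := by
    have := Finset.card_pos.2 ⟨i, hi⟩
    positivity
  have hm' : (0 : ℝ) < m := by positivity
  rw [MAR_mul_SNR_eq hm hi hmin] at h
  have h1 : (2 - δ) / ((pattern x).card * x i ^ 2 / m) * (pattern x).card * L =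
      (2 - δ) * L * m / x i ^ 2 := by
    field_simp
  rw [h1] at h
  have h2 : (m - (pattern x).card + 1 : ℝ) < (2 - δ) * L * m / x i ^ 2 := by linarith
  rw [lt_div_iff₀ hx] at h2
  have h3 : (m - (pattern x).card + 1 : ℝ) * (x i ^ 2 * (1 / m : ℝ≥0)) =
      (m - (pattern x).card + 1 : ℝ) * x i ^ 2 / m := by
    push_cast
    ring
  rw [h3, div_le_iff₀ hm']
  have h4 : (2 - δ) * L * m ≤ (2 - min δ 1) * L * m := by
    gcongr
    exact min_le_left _ _
  linarith

/-! ### Failure of maximum likelihood. -/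

lemma mlEstimates_eq_singleton_lt {m n k : ℕ} {A : Fin m → Fin n → ℝ}
    {y : EuclideanSpace ℝ (Fin m)} {I J : Finset (Fin n)} (h : mlEstimates k A y = {I})
    (hJ : J.card = k) (hne : J ≠ I) : energy A y J < energy A y I := by
  have hI : I ∈ mlEstimates k A y := by rw [h]; rfl
  refine lt_of_le_of_ne (hI.2 J hJ) fun heq => hne ?_
  have : J ∈ mlEstimates k A y := ⟨hJ, fun J' hJ' => heq ▸ hI.2 J' hJ'⟩
  rwa [h] at this

/-- The single-column test behind the maximum likelihood estimator: the pattern minus its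
smallest entry, the bounds on the dimension and on the number of competitors. -/
lemma test_condition {m n : ℕ} (hm : 0 < m) {x : EuclideanSpace ℝ (Fin n)} {i : Fin n}
    (hi : i ∈ pattern x) (hmin : ∀ j ∈ pattern x, |x i| ^ 2 ≤ |x j| ^ 2) {δ : ℝ}
    (hL : 0 < Real.log (n - (pattern x).card)) (hn : (pattern x).card < n)
    (h : (m : ℝ) < (2 - δ) / (MAR x * SNR m x) * (pattern x).card *
      Real.log (n - (pattern x).card) + (pattern x).card - 1) :
    ((m - ((pattern x).erase i).card : ℕ) : ℝ) * (x i ^ 2 * (1 / m : ℝ≥0)) ≤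
        (2 - min δ 1) * Real.log (n - (pattern x).card) ∧
      ENNReal.ofReal (Real.exp (Real.log (n - (pattern x).card))) ≤
        (Fintype.card {j // j ∉ (pattern x).erase i} : ℝ≥0∞) := by
  have hpos := Finset.card_pos.2 ⟨i, hi⟩
  have hcard : ((pattern x).erase i).card = (pattern x).card - 1 := Finset.card_erase_of_mem hi
  have hn' : (0 : ℝ) < n - (pattern x).card := by
    rw [sub_pos]; exact_mod_cast hn
  constructor
  · rcases le_or_gt ((pattern x).card - 1) m with hle | hlt
    · have hcast : ((m - ((pattern x).erase i).card : ℕ) : ℝ) = m - (pattern x).card + 1 := by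
        rw [hcard, Nat.cast_sub hle, Nat.cast_sub hpos]
        push_cast
        ring
      rw [hcast]
      exact dimension_condition hm hi hmin hL h
    -- Here the residual dimension is zero, and capping `δ` at `1` keeps the right side nonnegative.
    · rw [hcard, Nat.sub_eq_zero_of_le hlt.le, Nat.cast_zero, zero_mul]
      have := min_le_right δ 1
      exact mul_nonneg (by linarith) hL.le
  · rw [Real.exp_log hn', Fintype.card_subtype_compl, Fintype.card_fin, Fintype.card_coe, hcard]
    rw [ENNReal.ofReal_le_iff_le_toReal (by simp), ENNReal.toReal_natCast,
      Nat.cast_sub (by omega), Nat.cast_sub hpos]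
    push_cast
    linarith

theorem law_unique_le {m n : ℕ} (hm : 0 < m) {x : EuclideanSpace ℝ (Fin n)} {δ : ℝ} (hδ : 0 < δ)
    (hpos : 0 < (pattern x).card)
    (hL : 0 < Real.log (n - (pattern x).card)) (hn : (pattern x).card < n)
    (h : (m : ℝ) < (2 - δ) / (MAR x * SNR m x) * (pattern x).card *
      Real.log (n - (pattern x).card) + (pattern x).card - 1) :
    law m n {ω | mlEstimates (pattern x).card ω.1 (obs x ω) = {pattern x}} ≤
      successBound (min δ 1) (Real.log (n - (pattern x).card)) := by
  obtain ⟨i, hi, hmin⟩ := exists_min_pattern hpos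
  obtain ⟨hX, hN⟩ := test_condition hm hi hmin hL hn h
  obtain ⟨hτ, hb⟩ := le_successBound (lt_min hδ one_pos) hL hX
  have hiK : i ∉ (pattern x).erase i := Finset.notMem_erase i _
  have key := law_energy_insert_le hm (x := x) hiK (R := (· < ·))
    (fun j hj hji => by simpa [hji, mem_pattern] using hj) measurableSet_lt'
    (fun e a b hab => by linarith)
    ((measure_score_lt_le (1 / m : ℝ≥0) (x i) ⟨i, hiK⟩ hτ).trans (hb _ hN))
  refine (measure_mono ?_).trans key
  intro ω hω j hj hji
  rw [Finset.insert_erase hi]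
  have hjI : j ∉ pattern x := fun h => hj (Finset.mem_erase.2 ⟨hji, h⟩)
  refine mlEstimates_eq_singleton_lt hω ?_ fun heq => hjI (heq ▸ Finset.mem_insert_self j _)
  rw [Finset.card_insert_of_notMem hj, Finset.card_erase_of_mem hi]
  omega

/-- The hypothesis `k < m` leaves residual dimension at least two. In dimension one all nonzero
columns span the same line and their scores tie. -/
theorem law_mem_le {m n : ℕ} (hm : 0 < m) {x : EuclideanSpace ℝ (Fin n)} {δ : ℝ} (hδ : 0 < δ)
    (hpos : 0 < (pattern x).card)
    (hL : 0 < Real.log (n - (pattern x).card)) (hn : (pattern x).card < n)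
    (h : (m : ℝ) < (2 - δ) / (MAR x * SNR m x) * (pattern x).card *
      Real.log (n - (pattern x).card) + (pattern x).card - 1) (hkm : (pattern x).card < m) :
    law m n {ω | pattern x ∈ mlEstimates (pattern x).card ω.1 (obs x ω)} ≤
      successBound (min δ 1) (Real.log (n - (pattern x).card)) := by
  obtain ⟨i, hi, hmin⟩ := exists_min_pattern hpos
  obtain ⟨hX, hN⟩ := test_condition hm hi hmin hL hn h
  obtain ⟨hτ, hb⟩ := le_successBound (lt_min hδ one_pos) hL hX
  have hiK : i ∉ (pattern x).erase i := Finset.notMem_erase i _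
  have hcard : ((pattern x).erase i).card = (pattern x).card - 1 := Finset.card_erase_of_mem hi
  have key := law_energy_insert_le hm (x := x) hiK (R := (· ≤ ·))
    (fun j hj hji => by simpa [hji, mem_pattern] using hj) measurableSet_le'
    (fun e a b hab => by linarith)
    ((measure_score_le_le (σ := 1 / m) (by positivity) (x i) (by omega) ⟨i, hiK⟩ hτ).trans
      (hb _ hN))
  refine (measure_mono ?_).trans key
  intro ω hω j hj hji
  rw [Finset.insert_erase hi]
  refine hω.2 _ ?_
  rw [Finset.card_insert_of_notMem hj, hcard]
  omega

/-! ### Hard vectors for an arbitrary estimator. -/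

/-- The vector with entry `w` at `e`, entry `v` at the other indices of `J`, and `0` elsewhere. -/
def twoLevel {n : ℕ} (v w : ℝ) (e : Fin n) (J : Finset (Fin n)) : EuclideanSpace ℝ (Fin n) :=
  WithLp.toLp 2 fun l => if l = e then w else if l ∈ J then v else 0

lemma pattern_twoLevel {n : ℕ} {v w : ℝ} (hv : v ≠ 0) (hw : w ≠ 0) {e : Fin n}
    {J : Finset (Fin n)} (he : e ∈ J) : pattern (twoLevel v w e J) = J := by
  ext l
  rw [mem_pattern]
  by_cases hl : l = e
  · simp [twoLevel, hl, hw, he]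
  · simp [twoLevel, hl, hv]

lemma norm_sq_twoLevel {n : ℕ} (v w : ℝ) {e : Fin n} {J : Finset (Fin n)} (he : e ∈ J) :
    ‖twoLevel v w e J‖ ^ 2 = w ^ 2 + (J.card - 1) * v ^ 2 := by
  rw [EuclideanSpace.real_norm_sq_eq]
  have h : ∀ l, (twoLevel v w e J) l ^ 2 =
      (if l = e then w ^ 2 - v ^ 2 else 0) + if l ∈ J then v ^ 2 else 0 := by
    intro l
    by_cases hl : l = e
    · simp [twoLevel, hl, he]
    · by_cases hJ : l ∈ J <;> simp [twoLevel, hl, hJ]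
  simp only [h, Finset.sum_add_distrib, Finset.sum_ite_eq', Finset.mem_univ, if_true,
    Finset.sum_ite_mem, Finset.univ_inter, Finset.sum_const, nsmul_eq_mul]
  ring

lemma MAR_twoLevel {n : ℕ} {v w : ℝ} (hv : 0 < v) (hvw : v ≤ w) {e i : Fin n}
    {J : Finset (Fin n)} (he : e ∈ J) (hi : i ∈ J) (hie : i ≠ e) :
    MAR (twoLevel v w e J) = v ^ 2 / (‖twoLevel v w e J‖ ^ 2 / J.card) := by
  have hp := pattern_twoLevel hv.ne' (hv.trans_le hvw).ne' he
  have hxi : twoLevel v w e J i = v := by simp [twoLevel, hie, hi]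
  rw [MAR_eq (i := i) (by rwa [hp]), hxi, hp]
  intro l hl
  rw [hp] at hl
  have hxl : v ≤ twoLevel v w e J l := by
    by_cases h : l = e <;> simp [twoLevel, h, hl, hvw]
  rw [hxi, abs_of_pos hv, abs_of_pos (hv.trans_le hxl)]
  gcongr

lemma obs_twoLevel_insert {m n : ℕ} (v w : ℝ) {e j : Fin n} {K : Finset (Fin n)} (hj : j ∉ K)
    (he : e ∈ K) (A : Fin m → Fin n → ℝ) (d : Fin m → ℝ) :
    obs (twoLevel v w e (insert j K)) (A, d) =
      signal A (twoLevel v w e K) + WithLp.toLp 2 fun i => v * A i j + d i := by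
  have hje : j ≠ e := fun h => hj (h ▸ he)
  have h : ∀ l, twoLevel v w e (insert j K) l = twoLevel v w e K l + if l = j then v else 0 := by
    intro l
    by_cases hl : l = j
    · subst hl
      simp [twoLevel, hje, hj]
    · simp [twoLevel, hl]
  ext i
  simp only [obs, signal, Matrix.mulVec, dotProduct, PiLp.add_apply, h, mul_add,
    Finset.sum_add_distrib, Matrix.of_apply]
  simp
  ring

/-- For any estimator there is a vector with prescribed signal-to-noise ratio and
minimum-to-average ratio whose pattern it misses, unless the number of measurements is large. -/
theorem exists_hard_vector {m n k : ℕ} (hm : 0 < m) (hk : 2 ≤ k) (hkn : k < n)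
    (hL : 0 < Real.log (n - k)) {s ρ : ℝ} (hs : 0 < s) (hρ : 0 < ρ) (hρ1 : ρ ≤ 1)
    (est : (Fin m → Fin n → ℝ) × EuclideanSpace ℝ (Fin m) → Finset (Fin n))
    (hest : ∀ J, MeasurableSet (est ⁻¹' {J})) :
    ∃ x : EuclideanSpace ℝ (Fin n), (pattern x).card = k ∧ SNR m x = s ∧ MAR x = ρ ∧
      (ρ * s * m / k ≤ Real.log (n - k) →
        law m n {ω | est (ω.1, obs x ω) = pattern x} ≤ successBound 1 (Real.log (n - k))) := by
  have hm' : (0 : ℝ) < m := by positivity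
  have hk' : (0 : ℝ) < k := by positivity
  obtain ⟨K, hK⟩ : ∃ K : Finset (Fin n), K.card = k - 1 := by
    obtain ⟨K, -, hK⟩ := Finset.exists_subset_card_eq
      (s := (Finset.univ : Finset (Fin n))) (n := k - 1) (by rw [Finset.card_fin]; omega)
    exact ⟨K, hK⟩
  obtain ⟨e, he⟩ : K.Nonempty := Finset.card_pos.1 (by omega)
  have hv2 : 0 < ρ * s * m / k := by positivity
  -- This `v` makes the minimum-to-average ratio `ρ` once the squared norm is `s * m`. The entry `w`
  -- at `e` absorbs the rest of the norm, and `ρ ≤ 1` ensures `v ≤ w`.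
  set v := √(ρ * s * m / k) with hvdef
  have hv : 0 < v := Real.sqrt_pos.2 hv2
  have hvsq : v ^ 2 = ρ * s * m / k := Real.sq_sqrt hv2.le
  have hle : ρ * s * m / k ≤ s * m - (k - 1) * (ρ * s * m / k) := by
    have : ρ * s * m / k * k ≤ s * m := by
      rw [div_mul_cancel₀ _ hk'.ne', mul_assoc]
      exact mul_le_of_le_one_left (by positivity) hρ1
    linarith
  set w := √(s * m - (k - 1) * (ρ * s * m / k)) with hwdef
  have hvw : v ≤ w := Real.sqrt_le_sqrt hle
  have hwsq : w ^ 2 = s * m - (k - 1) * (ρ * s * m / k) := Real.sq_sqrt (hv2.le.trans hle)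
  have hcardJ : ∀ j, j ∉ K → (insert j K).card = k := fun j hj => by
    rw [Finset.card_insert_of_notMem hj]; omega
  have hpat : ∀ j, pattern (twoLevel v w e (insert j K)) = insert j K := fun j =>
    pattern_twoLevel hv.ne' (hv.trans_le hvw).ne' (Finset.mem_insert_of_mem he)
  have hnorm : ∀ j, j ∉ K → ‖twoLevel v w e (insert j K)‖ ^ 2 = s * m := fun j hj => by
    rw [norm_sq_twoLevel v w (Finset.mem_insert_of_mem he), hcardJ j hj, hwsq, hvsq]
    ring
  -- the events that the estimator returns `insert j K`, under the reference measure
  let σ : ℝ≥0 := 1 / m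
  let t : ℝ≥0 := 1 + (v ^ 2).toNNReal * σ
  have ht : (t : ℝ) = 1 + v ^ 2 * σ := by simp [t, sq_nonneg]
  -- The contribution of `K` is a function of `A`, the same for every candidate `j`; it is restored
  -- before the estimator is applied.
  let Φ : (Fin n → Fin m → ℝ) × (Fin m → ℝ) →
      (Fin m → Fin n → ℝ) × EuclideanSpace ℝ (Fin m) := fun p =>
    (fun i l => p.1 l i,
      signal (fun i l => p.1 l i) (twoLevel v w e K) + WithLp.toLp 2 p.2)
  have hΦ : Measurable Φ := by
    refine Continuous.measurable ?_
    unfold Φ signal Matrix.mulVec dotProduct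
    fun_prop
  let F : {j // j ∉ K} → Set ((Fin n → Fin m → ℝ) × (Fin m → ℝ)) := fun j =>
    Φ ⁻¹' (est ⁻¹' {insert j.1 K})
  have hF : ∀ j, MeasurableSet (F j) := fun j => hΦ (hest _)
  let Q := (Measure.pi fun _ : Fin n => gauss σ m).prod (gauss t m)
  have hdisj : Pairwise (Function.onFun Disjoint F) := by
    intro a b hab
    refine Set.disjoint_left.2 fun p ha hb => hab (Subtype.ext ?_)
    have hins : insert a.1 K = insert b.1 K := (show est (Φ p) = _ from ha).symm.trans hb
    have := hins ▸ Finset.mem_insert_self a.1 K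
    exact (Finset.mem_insert.1 this).resolve_right a.2
  have hcardc : Fintype.card {j // j ∉ K} = n - (k - 1) := by
    rw [Fintype.card_subtype_compl, Fintype.card_fin, Fintype.card_coe, hK]
  have hne : (Finset.univ : Finset {j // j ∉ K}).Nonempty := by
    rw [← Finset.card_pos, Finset.card_univ, hcardc]; omega
  have hsum : ∑ j, Q (F j) ≤ 1 := by
    rw [← tsum_fintype (L := .unconditional _), ← measure_iUnion hdisj hF]
    exact prob_le_one
  -- Pigeonhole: disjoint events have total probability at most one, so some candidate is rarely
  -- returned under the reference law.
  obtain ⟨j, hj⟩ : ∃ j, Q (F j) ≤ (Fintype.card {j // j ∉ K} : ℝ≥0∞)⁻¹ := by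
    by_contra! h
    have hlt := ENNReal.sum_lt_sum_of_nonempty hne fun j _ => h j
    rw [Finset.sum_const, Finset.card_univ, nsmul_eq_mul, ENNReal.mul_inv_cancel
      (by simp only [ne_eq, Nat.cast_eq_zero]; omega) (by simp)] at hlt
    exact hlt.not_ge hsum
  refine ⟨twoLevel v w e (insert j.1 K), by rw [hpat, hcardJ _ j.2], ?_, ?_, ?_⟩
  · rw [SNR_eq hm, hnorm _ j.2]
    field_simp
  · rw [MAR_twoLevel hv hvw (Finset.mem_insert_of_mem he) (Finset.mem_insert_self _ _)
      (ne_of_mem_of_not_mem he j.2).symm, hnorm _ j.2, hcardJ _ j.2, hvsq]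
    field_simp
  · intro hsmall
    have hX : (m : ℝ) * (v ^ 2 * σ) ≤ (2 - 1) * Real.log (n - k) := by
      have : (m : ℝ) * (v ^ 2 * σ) = v ^ 2 := by
        simp only [σ]
        push_cast
        field_simp
      rw [this, hvsq]
      linarith
    obtain ⟨hτ, hb⟩ := le_successBound one_pos hL hX
    have hn' : (0 : ℝ) < n - k := by
      rw [sub_pos]; exact_mod_cast hkn
    have hN : ENNReal.ofReal (Real.exp (Real.log (n - k))) ≤
        (Fintype.card {j // j ∉ K} : ℝ≥0∞) := by
      rw [Real.exp_log hn', hcardc, ENNReal.ofReal_le_iff_le_toReal (by simp),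
        ENNReal.toReal_natCast, Nat.cast_sub (by omega), Nat.cast_sub (by omega)]
      push_cast
      linarith
    refine le_trans ?_ (hb _ hN)
    have hE : MeasurableSet {ω : Sample m n | est (ω.1, obs (twoLevel v w e (insert j.1 K)) ω) =
        pattern (twoLevel v w e (insert j.1 K))} := measurable_obs _ (hest _)
    rw [← (measurePreserving_transpose m n).measure_preimage hE.nullMeasurableSet]
    have hset : (fun q : (Fin n → Fin m → ℝ) × (Fin m → ℝ) =>
        ((fun i j => q.1 j i, q.2) : Sample m n)) ⁻¹'
          {ω : Sample m n | est (ω.1, obs (twoLevel v w e (insert j.1 K)) ω) =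
            pattern (twoLevel v w e (insert j.1 K))} =
        {p | (p.1, fun i => v * p.1 j i + p.2 i) ∈ F j} := by
      ext p
      simp only [Set.mem_preimage, Set.mem_ofPred_eq, hpat, obs_twoLevel_insert v w j.2 he, F, Φ,
        Set.mem_singleton_iff]
    rw [hset]
    refine (measure_le_exp_mul_reference σ v ht j.1 hτ (hF j)).trans ?_
    gcongr

end SparseRecovery

end

/-! ### Passage to the limit. -/

open SparseRecovery in
theorem theorem1 (k m : ℕ → ℕ) (hm : ∀ᶠ n in atTop, 0 < m n)
    (hk : Tendsto k atTop atTop)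
    (hnk : Tendsto (fun n : ℕ => (n : ℝ) - k n) atTop atTop) :
    -- failure of the maximum likelihood estimator
    (∀ x : (n : ℕ) → EuclideanSpace ℝ (Fin n),
      (∀ᶠ n in atTop, (pattern (x n)).card = k n) →
      ∀ δ : ℝ, 0 < δ →
      (∀ᶠ n : ℕ in atTop, (m n : ℝ) <
        (2 - δ) / (MAR (x n) * SNR (m n) (x n)) * k n * Real.log ((n : ℝ) - k n) + k n - 1) →
      -- the true pattern is the (unique) maximizer
      Tendsto (fun n => law (m n) n
        {ω | mlEstimates (k n) ω.1 (obs (x n) ω) = {pattern (x n)}}) atTop (𝓝 0) ∧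
      -- if `m > k`, the same holds whatever the rule that breaks ties
      ((∀ᶠ n in atTop, k n < m n) →
        Tendsto (fun n => law (m n) n
          {ω | pattern (x n) ∈ mlEstimates (k n) ω.1 (obs (x n) ω)}) atTop (𝓝 0))) ∧
    -- for fixed SNR and MAR, `m = Ω(k log (n - k))` is necessary for any estimator that recovers
    -- the pattern of every `k`-sparse vector with probability tending to one
    (∀ s ρ : ℝ, 0 < s → 0 < ρ → ρ ≤ 1 →
      ∀ est : (n : ℕ) →
        (Fin (m n) → Fin n → ℝ) × EuclideanSpace ℝ (Fin (m n)) → Finset (Fin n),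
      (∀ n J, MeasurableSet (est n ⁻¹' {J})) →
      (∀ x : (n : ℕ) → EuclideanSpace ℝ (Fin n),
        (∀ᶠ n in atTop,
          (pattern (x n)).card = k n ∧ SNR (m n) (x n) = s ∧ MAR (x n) = ρ) →
        Tendsto (fun n => law (m n) n
          {ω | est n (ω.1, obs (x n) ω) = pattern (x n)}) atTop (𝓝 1)) →
      (fun n : ℕ => (k n : ℝ) * Real.log ((n : ℝ) - k n)) =O[atTop] fun n => (m n : ℝ)) := by
  have hlog : Tendsto (fun n : ℕ => Real.log ((n : ℝ) - k n)) atTop atTop :=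
    Real.tendsto_log_atTop.comp hnk
  have hLpos : ∀ᶠ n : ℕ in atTop, 0 < Real.log ((n : ℝ) - k n) := hlog.eventually_gt_atTop 0
  have hkn : ∀ᶠ n : ℕ in atTop, k n < n := by
    filter_upwards [hnk.eventually_gt_atTop 0] with n hn
    rw [sub_pos] at hn
    exact_mod_cast hn
  have hk2 : ∀ᶠ n in atTop, 2 ≤ k n := hk.eventually_ge_atTop 2
  refine ⟨fun x hx δ hδ hcond => ?_, fun s ρ hs hρ hρ1 est hest hsucc => ?_⟩
  · have hbound : Tendsto (fun n : ℕ => successBound (min δ 1) (Real.log ((n : ℝ) - k n))) atTop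
        (𝓝 0) := (tendsto_successBound (lt_min hδ one_pos)).comp hlog
    refine ⟨?_, fun hkm => ?_⟩
    · refine tendsto_of_tendsto_of_tendsto_of_le_of_le' tendsto_const_nhds hbound
        (Eventually.of_forall fun _ => zero_le) ?_
      filter_upwards [hm, hLpos, hkn, hk2, hx, hcond] with n hm hL hkn hk2 hx hcond
      rw [← hx] at hL hkn hk2 hcond ⊢
      exact law_unique_le hm hδ (by omega) hL hkn hcond
    · refine tendsto_of_tendsto_of_tendsto_of_le_of_le' tendsto_const_nhds hbound
        (Eventually.of_forall fun _ => zero_le) ?_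
      filter_upwards [hm, hLpos, hkn, hk2, hx, hcond, hkm] with n hm hL hkn hk2 hx hcond hkm
      rw [← hx] at hL hkn hk2 hcond hkm ⊢
      exact law_mem_le hm hδ (by omega) hL hkn hcond hkm
  · have hex : ∀ n, ∃ x : EuclideanSpace ℝ (Fin n),
        0 < m n → 2 ≤ k n → k n < n → 0 < Real.log ((n : ℝ) - k n) →
        (pattern x).card = k n ∧ SNR (m n) x = s ∧ MAR x = ρ ∧
        (ρ * s * m n / k n ≤ Real.log (n - k n) →
          law (m n) n {ω | est n (ω.1, obs x ω) = pattern x} ≤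
            successBound 1 (Real.log (n - k n))) := by
      intro n
      by_cases h : 0 < m n ∧ 2 ≤ k n ∧ k n < n ∧ 0 < Real.log ((n : ℝ) - k n)
      · obtain ⟨h1, h2, h3, h4⟩ := h
        obtain ⟨x, hx⟩ := exists_hard_vector h1 h2 h3 h4 hs hρ hρ1 (est n) (hest n)
        exact ⟨x, fun _ _ _ _ => hx⟩
      · exact ⟨0, fun h1 h2 h3 h4 => absurd ⟨h1, h2, h3, h4⟩ h⟩
    choose x hx using hex
    have hlim := hsucc x (by
      filter_upwards [hm, hk2, hkn, hLpos] with n h1 h2 h3 h4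
      obtain ⟨a, b, c, -⟩ := hx n h1 h2 h3 h4
      exact ⟨a, b, c⟩)
    have hhalf : (2⁻¹ : ENNReal) < 1 := ENNReal.inv_lt_one.2 ENNReal.one_lt_two
    have hbound : Tendsto (fun n : ℕ => successBound 1 (Real.log ((n : ℝ) - k n))) atTop (𝓝 0) :=
      (tendsto_successBound one_pos).comp hlog
    refine IsBigO.of_bound (ρ * s) ?_
    filter_upwards [hm, hk2, hkn, hLpos, hlim.eventually_const_lt hhalf,
      hbound.eventually_lt_const (u := 2⁻¹) (by simp)] with n h1 h2 h3 h4 h5 h6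
    obtain ⟨-, -, -, h⟩ := hx n h1 h2 h3 h4
    have hk0 : (0 : ℝ) < k n := by positivity
    -- Otherwise the success probability would be both above and below one half. The inequality also
    -- explains the constant `ρ * s`.
    have hlt : Real.log (n - k n) < ρ * s * m n / k n := by
      by_contra hcon
      exact absurd ((h (not_lt.1 hcon)).trans_lt h6) (not_lt.2 h5.le)
    rw [lt_div_iff₀ hk0] at hlt
    rw [Real.norm_of_nonneg (by positivity), Real.norm_of_nonneg (by positivity)]
    linarith
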